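/- There are an absolute constant $c>0$ and a polynomial $P$ such that the following holds. Let $G=(V,E)$ be a finite directed graph (parallel edges allowed) with $m=|E|$ edges, and let there be $k$ commodities, commodity $i$ having source $s_i$, sink $t_i$ and demand $d_i\ge 0$. A multicommodity flow $f=(f^i_e)_{i\in[k],\,e\in E}$ is \emph{feasible} if each $f^i\ge 0$ is an $s_i$–$t_i$ flow of value $d_i$; assume that a feasible flow exists. Put $N=mk$, let $f_e=\sum_i f^i_e$, and for latency functions $l=(l_e)_{e\in E}$ let $\mathrm{cost}(f,l)=\sum_{e} f_e\,l_e(f_e)$ be the total latency. Let $C$ be the convex body of feasible flows with $f^i_e\le d_i$ for all $i,e$ (a bound that every acyclic feasible flow satisfies). Let $r\in\mathbb{N}$, $K>0$, $\epsilon>0$ and $\delta\ge 0$ with $P(N)\,\delta\le\epsilon$. Then there is a deterministic adaptive query algorithm, which may depend on $G,(s_i,t_i,d_i)_i,r,K,\epsilon,\delta$ but not on the latency functions, with the following property. Let the unknown latency functions $l^*_e$ be polynomials of degree at most $r$ with nonnegative coefficients and with $l^*_e(x)\le K$ for $0\le x\le\sum_i d_i$, and let the algorithm be given any zero-order $\delta$-oracle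 for the total latency, i.e. a function $\psi:C\to\mathbb{R}$ with $|\psi(f)-\mathrm{cost}(f,l^*)|\le\delta$ for all $f\in C$. Then an optimal flow $f^*$ (a feasible flow of minimum total latency among all feasible flows) exists, and after at most $$c\,N^7\,\log N\,\log\!\Big(2+\frac{N K\sum_i d_i}{\epsilon}\Big)$$ queries to $\psi$, all at points of $C$, the algorithm outputs a feasible flow $\hat f$ with $\mathrm{cost}(\hat f,l^*)-\mathrm{cost}(f^*,l^*)\le\epsilon$. -/

import Mathlib

/-- The publicly known data of a multicommodity nonatomic routing game: a finite directed
(multi)graph with vertices `V` and edges `E`, and `k` commodities, commodity `i` having source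
`source i`, sink `sink i` and demand `demand i`.  The latency functions are not part of it. -/
structure RoutingInstance (V E : Type*) (k : ℕ) where
  /-- tail of an edge -/
  tail : E → V
  /-- head of an edge -/
  head : E → V
  source : Fin k → V
  sink : Fin k → V
  demand : Fin k → ℝ
  demand_nonneg : ∀ i, 0 ≤ demand i

namespace RoutingInstance

variable {V E : Type*} [Fintype E] [DecidableEq V] {k : ℕ}

/-- The total demand `∑ᵢ dᵢ`. -/
noncomputable def totalDemand (G : RoutingInstance V E k) : ℝ := ∑ i, G.demand i

/-- `f i e` is the amount of commodity `i` on edge `e`.  The multicommodity flow `f` is feasible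
if each `f i` is a (nonnegative) flow from `source i` to `sink i` of value `demand i`. -/
structure IsFeasible (G : RoutingInstance V E k) (f : Fin k → E → ℝ) : Prop where
  nonneg : ∀ i e, 0 ≤ f i e
  conservation : ∀ i v,
    (∑ e with G.tail e = v, f i e) - (∑ e with G.head e = v, f i e)
      = (if v = G.source i then G.demand i else 0) - (if v = G.sink i then G.demand i else 0)

/-- The convex body of feasible flows.  If the graph has directed cycles, feasibility alone does
not bound a flow, so the flow of a commodity on an edge is also bounded by the demand of that
commodity (this holds for every acyclic feasible flow). -/
def flowBody (G : RoutingInstance V E k) : Set (Fin k → E → ℝ) :=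
  {f | G.IsFeasible f ∧ ∀ i e, f i e ≤ G.demand i}

end RoutingInstance

/-- The total flow `f_e = ∑ᵢ fⁱ_e` on an edge. -/
noncomputable def edgeFlow {E : Type*} {k : ℕ} (f : Fin k → E → ℝ) (e : E) : ℝ := ∑ i, f i e

/-- The total latency `cost(f, l) = ∑ₑ f_e l_e(f_e)`. -/
noncomputable def totalLatency {E : Type*} [Fintype E] {k : ℕ}
    (l : E → Polynomial ℝ) (f : Fin k → E → ℝ) : ℝ :=
  ∑ e, edgeFlow f e * (l e).eval (edgeFlow f e)

/-- `p` is a latency function that is a polynomial of degree at most `r` with nonnegative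
coefficients and whose values at flows in `[0, D]` are at most `K`. -/
structure IsStandardLatency (r : ℕ) (K D : ℝ) (p : Polynomial ℝ) : Prop where
  degree_le : p.natDegree ≤ r
  coeff_nonneg : ∀ j, 0 ≤ p.coeff j
  eval_le : ∀ x, 0 ≤ x → x ≤ D → p.eval x ≤ K

/-- `f` is an optimal flow: a feasible flow of minimum total latency among all feasible flows. -/
def RoutingInstance.IsOptimal {V E : Type*} [Fintype E] [DecidableEq V] {k : ℕ}
    (G : RoutingInstance V E k) (l : E → Polynomial ℝ) (f : Fin k → E → ℝ) : Prop :=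
  G.IsFeasible f ∧ ∀ g, G.IsFeasible g → totalLatency l f ≤ totalLatency l g

/-- `ψ` is a zero-order `δ`-oracle for the function `F` on the set `C`. -/
def IsZeroOrderOracle {X : Type*} (C : Set X) (F : X → ℝ) (δ : ℝ) (ψ : C → ℝ) : Prop :=
  ∀ x : C, |ψ x - F x| ≤ δ

/-- Deterministic adaptive algorithms that query real-valued oracles at points of `X` and output
a point of `X`: either stop with an output, or query a point and continue depending on the
answer. -/
inductive QueryAlgorithm (X : Type*) where
  | output (x : X) : QueryAlgorithm X
  | query (x : X) (next : ℝ → QueryAlgorithm X) : QueryAlgorithm X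

namespace QueryAlgorithm

variable {X : Type*}

/-- The output of the algorithm when its queries are answered by `ψ`. -/
def result (ψ : X → ℝ) : QueryAlgorithm X → X
  | output x => x
  | query x next => result ψ (next (ψ x))

/-- The number of queries the algorithm makes when they are answered by `ψ`. -/
def numQueries (ψ : X → ℝ) : QueryAlgorithm X → ℕ
  | output _ => 0
  | query x next => numQueries ψ (next (ψ x)) + 1

end QueryAlgorithm

/-- `QueryBound n g` says that `g ψ` can be computed with at most `n` adaptive queries to the
oracle `ψ`. -/
inductive QueryBound {X α : Type*} : ℕ → ((X → ℝ) → α) → Prop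
  | const (n : ℕ) (a : α) : QueryBound n (fun _ => a)
  | query (n : ℕ) (x : X) (g : ℝ → (X → ℝ) → α) :
      (∀ r, QueryBound n (g r)) → QueryBound (n + 1) (fun ψ => g (ψ x) ψ)

namespace QueryBound

variable {X Y α β S : Type*}

theorem mono {n m : ℕ} {g : (X → ℝ) → α} (h : QueryBound n g) (hnm : n ≤ m) :
    QueryBound m g := by
  induction h generalizing m with
  | const n a => exact const m a
  | query n x g _ ih =>
    obtain ⟨m, rfl⟩ : ∃ m', m = m' + 1 := ⟨m - 1, by omega⟩
    exact query m x g fun r => ih r (by omega)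

theorem bind {n m : ℕ} {g : (X → ℝ) → α} {h : α → (X → ℝ) → β} (hg : QueryBound n g)
    (hh : ∀ a, QueryBound m (h a)) : QueryBound (n + m) (fun ψ => h (g ψ) ψ) := by
  induction hg with
  | const n a => exact (hh a).mono (by omega)
  | query n x g _ ih =>
    rw [show n + 1 + m = n + m + 1 by omega]
    exact query (n + m) x (fun r ψ => h (g r ψ) ψ) ih

theorem map {n : ℕ} {g : (X → ℝ) → α} (hg : QueryBound n g) (h : α → β) :
    QueryBound n (fun ψ => h (g ψ)) :=
  hg.bind (m := 0) (h := fun a _ => h a) fun a => const 0 (h a)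

theorem comap {n : ℕ} {g : (X → ℝ) → α} (hg : QueryBound n g) (φ : X → Y) :
    QueryBound n (fun ψ : Y → ℝ => g (ψ ∘ φ)) := by
  induction hg with
  | const n a => exact const n a
  | query n x g _ ih => exact query n (φ x) (fun r ψ => g r (ψ ∘ φ)) ih

theorem iterate {p : ℕ} {step : (X → ℝ) → S → S} (h : ∀ s, QueryBound p (fun ψ => step ψ s))
    (T : ℕ) : ∀ s, QueryBound (T * p) (fun ψ => (step ψ)^[T] s) := by
  induction T with
  | zero => intro s; exact const _ s
  | succ T ih =>
    intro s
    simp only [Function.iterate_succ, Function.comp]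
    exact ((h s).bind (h := fun a ψ => (step ψ)^[T] a) ih).mono (by lia)

theorem exists_algorithm {n : ℕ} {g : (X → ℝ) → X} (hg : QueryBound n g) :
    ∃ A : QueryAlgorithm X, ∀ ψ, A.numQueries ψ ≤ n ∧ A.result ψ = g ψ := by
  induction hg with
  | const n a => exact ⟨.output a, fun ψ => ⟨by simp [QueryAlgorithm.numQueries], rfl⟩⟩
  | query n x g _ ih =>
    choose A hA using ih
    refine ⟨.query x A, fun ψ => ⟨?_, ?_⟩⟩
    · simpa [QueryAlgorithm.numQueries] using (hA (ψ x) ψ).1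
    · simpa [QueryAlgorithm.result] using (hA (ψ x) ψ).2

end QueryBound

open Classical in
/-- The extension by zero of a function on `C`. -/
noncomputable def extendZero {X : Type*} (C : Set X) (ψ : C → ℝ) (x : X) : ℝ :=
  if h : x ∈ C then ψ ⟨x, h⟩ else 0

theorem extendZero_of_mem {X : Type*} {C : Set X} (ψ : C → ℝ) {x : X} (h : x ∈ C) :
    extendZero C ψ x = ψ ⟨x, h⟩ := by
  simp [extendZero, h]

namespace QueryBound

variable {X Y α ι : Type*}

theorem extendZero (C : Set X) (x : X) : QueryBound 1 (fun ψ => extendZero C ψ x) := by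
  classical
  by_cases h : x ∈ C
  · simp only [_root_.extendZero, h, dite_true]
    exact query 0 (⟨x, h⟩ : C) (fun r _ => r) fun r => const 0 r
  · simp only [_root_.extendZero, h, dite_false]
    exact const 1 0

theorem extendZero_family [Fintype ι] (C : Set X) (x : ι → X) :
    QueryBound (Fintype.card ι) (fun ψ i => _root_.extendZero C ψ (x i)) := by
  classical
  have key : ∀ s : Finset ι, QueryBound s.card
      (fun ψ i => if i ∈ s then _root_.extendZero C ψ (x i) else 0) := by
    intro s
    induction s using Finset.induction_on with
    | empty => simpa using const 0 (fun _ : ι => (0 : ℝ))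
    | insert a s ha ih =>
      rw [Finset.card_insert_of_notMem ha]
      have := ih.bind (h := fun v ψ => Function.update v a (_root_.extendZero C ψ (x a)))
        fun v => (extendZero C (x a)).map fun r => Function.update v a r
      convert this using 3 with ψ i
      by_cases hi : i = a
      · subst hi; simp
      · simp [hi, Finset.mem_insert]
  simpa using key Finset.univ

end QueryBound

open scoped RealInnerProductSpace

/-- The sign `±1` encoded by a Boolean. -/
def boolSign (b : Bool) : ℝ := if b then 1 else -1

theorem abs_boolSign (b : Bool) : |boolSign b| = 1 := by
  cases b <;> simp [boolSign]

theorem Convex.add_sum_smul_mem {W ι : Type*} [AddCommGroup W] [Module ℝ W] [Fintype ι]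
    [Nonempty ι] {S : Set W} (hS : Convex ℝ S) {p : W} {d : ι → W}
    (h : ∀ j b, p + boolSign b • d j ∈ S) {a : ι → ℝ} (ha : ∑ j, |a j| ≤ 1) :
    p + ∑ j, a j • d j ∈ S := by
  have hp : p ∈ S := by
    obtain ⟨j⟩ := ‹Nonempty ι›
    have h1 := h j true
    have h2 := h j false
    have := hS h1 h2 (by norm_num : (0 : ℝ) ≤ 1 / 2) (by norm_num : (0 : ℝ) ≤ 1 / 2) (by norm_num)
    convert this using 1
    simp only [boolSign, if_true, Bool.false_eq_true, if_false]
    module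
  have key := hS.sum_mem (t := (Finset.univ : Finset (Option ι)))
    (w := fun o => o.elim (1 - ∑ j, |a j|) fun j => |a j|)
    (z := fun o => o.elim p fun j => p + boolSign (decide (0 ≤ a j)) • d j) ?_ ?_ ?_
  · convert key using 1
    simp only [Fintype.sum_option, Option.elim, smul_add, Finset.sum_add_distrib,
      ← Finset.sum_smul]
    rw [← add_assoc, ← add_smul, sub_add_cancel, one_smul]
    congr 1
    refine Finset.sum_congr rfl fun j _ => ?_
    rw [smul_smul]
    congr 1
    by_cases hj : 0 ≤ a j
    · simp [boolSign, hj, abs_of_nonneg hj]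
    · simp [boolSign, hj, abs_of_neg (not_le.mp hj)]
  · rintro (_ | j) _
    · simpa using ha
    · exact abs_nonneg _
  · simp [Fintype.sum_option]
  · rintro (_ | j) _
    · exact hp
    · exact h _ _

section LocalSearch

variable {n : ℕ}

/-- The component of `y` orthogonal to `w`. -/
noncomputable def orthPart (w y : EuclideanSpace ℝ (Fin n)) : EuclideanSpace ℝ (Fin n) :=
  y - (⟪w, y⟫ / ‖w‖ ^ 2) • w

/-- The points around `(1 - t²) w` at which the local search queries the oracle. -/
noncomputable def probe (t : ℝ) (w : EuclideanSpace ℝ (Fin n)) (j : Fin n × Bool) :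
    EuclideanSpace ℝ (Fin n) :=
  (1 - t ^ 2) • w + boolSign j.2 • ((t * ‖w‖) • orthPart w (EuclideanSpace.single j.1 1))

theorem inner_orthPart {w : EuclideanSpace ℝ (Fin n)} (hw : w ≠ 0)
    (y : EuclideanSpace ℝ (Fin n)) : ⟪w, orthPart w y⟫ = 0 := by
  have : ‖w‖ ≠ 0 := norm_ne_zero_iff.mpr hw
  simp only [orthPart, inner_sub_right, inner_smul_right, real_inner_self_eq_norm_sq]
  field_simp
  ring

theorem norm_orthPart_sq_le {w : EuclideanSpace ℝ (Fin n)} (hw : w ≠ 0)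
    (y : EuclideanSpace ℝ (Fin n)) : ‖orthPart w y‖ ^ 2 ≤ ‖y‖ ^ 2 := by
  have h : ‖y‖ ^ 2 = ‖orthPart w y + (⟪w, y⟫ / ‖w‖ ^ 2) • w‖ ^ 2 := by
    congr 2; simp [orthPart]
  rw [h, norm_add_sq_real, inner_smul_right, real_inner_comm w, inner_orthPart hw]
  nlinarith [sq_nonneg ‖(⟪w, y⟫ / ‖w‖ ^ 2) • w‖]

theorem sum_smul_orthPart_single (w y : EuclideanSpace ℝ (Fin n)) :
    ∑ j, y j • orthPart w (EuclideanSpace.single j 1) = orthPart w y := by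
  have hy : y = ∑ j, y j • EuclideanSpace.single j (1 : ℝ) := by
    ext i
    simp [Finset.sum_apply, Pi.single_apply]
  have hin : ⟪w, y⟫ = ∑ j, y j * ⟪w, EuclideanSpace.single j (1 : ℝ)⟫ := by
    conv_lhs => rw [hy]
    simp only [inner_sum, inner_smul_right]
  simp only [orthPart, smul_sub, Finset.sum_sub_distrib, ← hy, smul_smul, ← Finset.sum_smul]
  rw [hin, Finset.sum_div]
  simp only [mul_div_assoc]

theorem norm_probe_sq_le {t : ℝ} (ht : t ^ 2 ≤ 1 / 2) {w : EuclideanSpace ℝ (Fin n)} (hw : w ≠ 0)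
    (j : Fin n × Bool) : ‖probe t w j‖ ^ 2 ≤ (1 - t ^ 2 / 2) * ‖w‖ ^ 2 := by
  have h1 : ‖orthPart w (EuclideanSpace.single j.1 (1 : ℝ))‖ ^ 2 ≤ 1 := by
    simpa using norm_orthPart_sq_le hw (EuclideanSpace.single j.1 (1 : ℝ))
  rw [probe, norm_add_sq_real]
  simp only [inner_smul_left, inner_smul_right, inner_orthPart hw, norm_smul, mul_pow,
    Real.norm_eq_abs, abs_boolSign, sq_abs, mul_zero, add_zero, one_mul,
    abs_mul, abs_norm]
  nlinarith [mul_le_mul_of_nonneg_left h1 (by positivity : (0 : ℝ) ≤ t ^ 2 * ‖w‖ ^ 2),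
    sq_nonneg ‖w‖, mul_nonneg (mul_nonneg (sq_nonneg t) (sub_nonneg.mpr ht)) (sq_nonneg ‖w‖)]

theorem probe_ne_zero {t : ℝ} (ht : t ^ 2 ≤ 1 / 2) {w : EuclideanSpace ℝ (Fin n)} (hw : w ≠ 0)
    (j : Fin n × Bool) : probe t w j ≠ 0 := by
  intro h
  have h2 : ⟪w, probe t w j⟫ = (1 - t ^ 2) * ‖w‖ ^ 2 := by
    simp [probe, inner_add_right, inner_smul_right, inner_orthPart hw]
  rw [h, inner_zero_right] at h2
  have : 0 < ‖w‖ := norm_pos_iff.mpr hw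
  have : 0 < (1 - t ^ 2) * ‖w‖ ^ 2 := mul_pos (by linarith) (by positivity)
  linarith

theorem sum_abs_le_sqrt_mul_norm (y : EuclideanSpace ℝ (Fin n)) :
    ∑ j, |y j| ≤ √n * ‖y‖ := by
  have h := sq_sum_le_card_mul_sum_sq (s := (Finset.univ : Finset (Fin n))) (f := fun j => |y j|)
  rw [EuclideanSpace.norm_eq, ← Real.sqrt_mul (Nat.cast_nonneg n)]
  refine Real.le_sqrt_of_sq_le ?_
  simpa using h

theorem le_of_probe_le (hn : 0 < n) {C : Set (EuclideanSpace ℝ (Fin n))}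
    {F : EuclideanSpace ℝ (Fin n) → ℝ} (hF : ConvexOn ℝ C F) {w y : EuclideanSpace ℝ (Fin n)}
    (hw : w ≠ 0) {t σ ρ β : ℝ} (ht : 0 < t) (hσ : 0 ≤ σ) (hwρ : ‖w‖ ≤ ρ) (hρβ : ρ < β)
    (htβ : t * √n ≤ β - ρ) (hmem : ∀ j, probe t w j ∈ C) (hle : ∀ j, F (probe t w j) ≤ F w + σ)
    (hyC : y ∈ C) (hy : ‖y‖ ≤ 1) (hwy : β < ⟪‖w‖⁻¹ • w, y⟫) :
    F w ≤ F y + σ / (t ^ 2 * ‖w‖) := by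
  have : Nonempty (Fin n) := ⟨⟨0, hn⟩⟩
  have hw0 : 0 < ‖w‖ := norm_pos_iff.mpr hw
  rw [inner_smul_left] at hwy
  simp only [conj_trivial] at hwy
  set D : ℝ := ‖w‖⁻¹ * ⟪w, y⟫ - ‖w‖ with hD
  have hDpos : 0 < D := by linarith
  have hD1 : D ≤ 1 := by
    have := real_inner_le_norm w y
    have h2 : ‖w‖⁻¹ * ⟪w, y⟫ ≤ ‖w‖⁻¹ * (‖w‖ * ‖y‖) := by gcongr
    rw [inv_mul_cancel_left₀ hw0.ne'] at h2
    linarith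
  set μ : ℝ := t ^ 2 * ‖w‖ / D with hμ
  have hμpos : 0 < μ := by positivity
  have hz := (hF.convex_le (F w + σ)).add_sum_smul_mem (p := (1 - t ^ 2) • w)
    (d := fun j => (t * ‖w‖) • orthPart w (EuclideanSpace.single j 1))
    (a := fun j => -(t / D) * y j) (fun j b => ⟨hmem (j, b), hle (j, b)⟩) (by
      simp only [abs_mul, abs_neg, ← Finset.mul_sum]
      rw [abs_of_pos (by positivity : 0 < t / D)]
      have h1 := sum_abs_le_sqrt_mul_norm y
      calc t / D * ∑ j, |y j| ≤ t / D * (√n * 1) := by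
            gcongr
            exact h1.trans (by gcongr)
        _ = (t * √n) / D := by ring
        _ ≤ 1 := by rw [div_le_one hDpos]; linarith)
  have hzeq : (1 - t ^ 2) • w + ∑ j, (-(t / D) * y j) •
      (t * ‖w‖) • orthPart w (EuclideanSpace.single j 1) = (1 + μ) • w - μ • y := by
    have : ∑ j, (-(t / D) * y j) • (t * ‖w‖) • orthPart w (EuclideanSpace.single j 1)
        = (-μ) • ∑ j, y j • orthPart w (EuclideanSpace.single j 1) := by
      rw [Finset.smul_sum]
      refine Finset.sum_congr rfl fun j _ => ?_
      simp only [smul_smul]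
      congr 1
      rw [hμ]; ring
    rw [this, sum_smul_orthPart_single, orthPart]
    have h2 : μ * (⟪w, y⟫ / ‖w‖ ^ 2) = t ^ 2 + μ := by
      have h3 : ⟪w, y⟫ = ‖w‖ * (D + ‖w‖) := by rw [hD]; field_simp; ring
      rw [h3, hμ]; field_simp
    rw [smul_sub, smul_smul, show -μ * (⟪w, y⟫ / ‖w‖ ^ 2) = -(t ^ 2 + μ) by rw [← h2]; ring]
    module
  rw [hzeq] at hz
  have hconv := hF.2 hyC hz.1 (by positivity : 0 ≤ μ / (1 + μ))
    (by positivity : 0 ≤ 1 / (1 + μ)) (by field_simp; ring)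
  have hweq : (μ / (1 + μ)) • y + (1 / (1 + μ)) • ((1 + μ) • w - μ • y) = w := by
    rw [smul_sub, smul_smul, smul_smul, one_div_mul_cancel (by positivity)]
    rw [show 1 / (1 + μ) * μ = μ / (1 + μ) by ring]
    module
  rw [hweq, smul_eq_mul, smul_eq_mul] at hconv
  have hz2 := hz.2
  have h4 : (1 + μ) * F w ≤ μ * F y + (F w + σ) := by
    have : (1 + μ) * F w ≤ (1 + μ) * (μ / (1 + μ) * F y +
      1 / (1 + μ) * F ((1 + μ) • w - μ • y)) := by gcongr
    have h5 : (1 + μ) * (μ / (1 + μ) * F y + 1 / (1 + μ) * F ((1 + μ) • w - μ • y))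
      = μ * F y + F ((1 + μ) • w - μ • y) := by field_simp
    linarith
  have h6 : F w ≤ F y + σ / μ := by
    rw [← sub_le_iff_le_add', le_div_iff₀ hμpos]; linarith
  refine h6.trans ?_
  gcongr
  rw [hμ, le_div_iff₀ hDpos]
  exact mul_le_of_le_one_right (by positivity) hD1

end LocalSearch

section LocalSearch

variable {n : ℕ}

/-- An index at which a function on a finite nonempty type is maximal. -/
noncomputable def argmax {ι : Type*} [Finite ι] [Nonempty ι] (v : ι → ℝ) : ι :=
  (Finite.exists_max v).choose

theorem le_argmax {ι : Type*} [Finite ι] [Nonempty ι] (v : ι → ℝ) (i : ι) :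
    v i ≤ v (argmax v) :=
  (Finite.exists_max v).choose_spec i

/-- The vertices of the cross-polytope of radius `ρ`. -/
noncomputable def crossVertex (ρ : ℝ) (j : Fin n × Bool) : EuclideanSpace ℝ (Fin n) :=
  boolSign j.2 • ρ • EuclideanSpace.single j.1 1

theorem norm_crossVertex {ρ : ℝ} (hρ : 0 ≤ ρ) (j : Fin n × Bool) : ‖crossVertex ρ j‖ = ρ := by
  simp [crossVertex, norm_smul, abs_boolSign, abs_of_nonneg hρ]

open Classical in
/-- One step of the local search: move to the best probe if it improves on `h w` by `3 δ`. -/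
noncomputable def localStep [NeZero n] (C : Set (EuclideanSpace ℝ (Fin n))) (t δ : ℝ)
    (h : EuclideanSpace ℝ (Fin n) → ℝ) (w : EuclideanSpace ℝ (Fin n)) :
    EuclideanSpace ℝ (Fin n) :=
  if (∀ j, probe t w j ∈ C) ∧ h w + 3 * δ ≤ h (probe t w (argmax fun j => h (probe t w j)))
  then probe t w (argmax fun j => h (probe t w j)) else w

variable [NeZero n] {C : Set (EuclideanSpace ℝ (Fin n))} {t δ : ℝ}
  {h : EuclideanSpace ℝ (Fin n) → ℝ} {w : EuclideanSpace ℝ (Fin n)}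

theorem localStep_eq_or (ht : t ^ 2 ≤ 1 / 2) (hw : w ≠ 0) :
    localStep C t δ h w = w ∨ (localStep C t δ h w ∈ C ∧ localStep C t δ h w ≠ 0 ∧
      ‖localStep C t δ h w‖ ^ 2 ≤ (1 - t ^ 2 / 2) * ‖w‖ ^ 2 ∧
      h w + 3 * δ ≤ h (localStep C t δ h w)) := by
  unfold localStep
  split_ifs with hc
  · exact Or.inr ⟨hc.1 _, probe_ne_zero ht hw _, norm_probe_sq_le ht hw _, hc.2⟩
  · exact Or.inl rfl

theorem lt_of_localStep_eq (hδ : 0 < δ) (hs : localStep C t δ h w = w)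
    (hm : ∀ j, probe t w j ∈ C) (j : Fin n × Bool) : h (probe t w j) < h w + 3 * δ := by
  by_contra hj
  have hc : h w + 3 * δ ≤ h (probe t w (argmax fun j => h (probe t w j))) :=
    (not_lt.mp hj).trans (le_argmax (fun j => h (probe t w j)) j)
  rw [localStep, if_pos ⟨hm, hc⟩] at hs
  rw [hs] at hc
  linarith

theorem iterate_localStep (ht : t ^ 2 ≤ 1 / 2) (hδ : 0 < δ) (hwC : w ∈ C) (hw : w ≠ 0) (k : ℕ) :
    (localStep C t δ h)^[k] w ∈ C ∧ (localStep C t δ h)^[k] w ≠ 0 ∧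
      ‖(localStep C t δ h)^[k] w‖ ≤ ‖w‖ ∧
      ((localStep C t δ h)^[k] w = w ∨ h w + 3 * δ ≤ h ((localStep C t δ h)^[k] w)) ∧
      (localStep C t δ h ((localStep C t δ h)^[k] w) = (localStep C t δ h)^[k] w ∨
        ‖(localStep C t δ h)^[k] w‖ ^ 2 ≤ (1 - t ^ 2 / 2) ^ k * ‖w‖ ^ 2) := by
  induction k with
  | zero => exact ⟨hwC, hw, le_rfl, Or.inl rfl, Or.inr (by simp)⟩
  | succ k ih =>
    rw [Function.iterate_succ_apply']
    obtain ⟨h1, h2, h3, h4, h5⟩ := ih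
    set u := (localStep C t δ h)^[k] w
    rcases localStep_eq_or (C := C) (δ := δ) (h := h) ht h2 with hs | ⟨s1, s2, s3, s4⟩
    · simp only [hs]
      exact ⟨h1, h2, h3, h4, Or.inl trivial⟩
    · refine ⟨s1, s2, ?_, ?_, ?_⟩
      · refine le_trans ?_ h3
        have : ‖localStep C t δ h u‖ ^ 2 ≤ ‖u‖ ^ 2 :=
          s3.trans (mul_le_of_le_one_left (sq_nonneg _) (by nlinarith [sq_nonneg t]))
        exact (pow_le_pow_iff_left₀ (norm_nonneg _) (norm_nonneg _) two_ne_zero).mp this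
      · rcases h4 with h4 | h4
        · rw [← h4]; exact Or.inr s4
        · exact Or.inr (by linarith)
      · rcases h5 with h5 | h5
        · rw [h5] at s4; linarith
        · right
          calc ‖localStep C t δ h u‖ ^ 2 ≤ (1 - t ^ 2 / 2) * ‖u‖ ^ 2 := s3
            _ ≤ (1 - t ^ 2 / 2) * ((1 - t ^ 2 / 2) ^ k * ‖w‖ ^ 2) := by
              gcongr; linarith
            _ = (1 - t ^ 2 / 2) ^ (k + 1) * ‖w‖ ^ 2 := by ring

theorem le_of_crossVertex_le {F : EuclideanSpace ℝ (Fin n) → ℝ} (hF : ConvexOn ℝ C F) {ρ m : ℝ}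
    (hρ : 0 < ρ) (hC : ∀ j, crossVertex ρ j ∈ C) (hm : ∀ j, F (crossVertex ρ j) ≤ m)
    (hw : √n * ‖w‖ ≤ ρ) : F w ≤ m := by
  have : Nonempty (Fin n) := ⟨0⟩
  have key := (hF.convex_le m).add_sum_smul_mem (p := 0)
    (d := fun j => ρ • EuclideanSpace.single j (1 : ℝ)) (a := fun j => w j / ρ)
    (fun j b => by rw [zero_add]; exact ⟨hC (j, b), hm (j, b)⟩) (by
      simp only [abs_div, abs_of_pos hρ, ← Finset.sum_div]
      rw [div_le_one hρ]
      exact (sum_abs_le_sqrt_mul_norm w).trans hw)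
  have hweq : (0 : EuclideanSpace ℝ (Fin n)) +
      ∑ j, (w j / ρ) • ρ • EuclideanSpace.single j (1 : ℝ) = w := by
    ext i
    simp [Finset.sum_apply, Pi.single_apply, hρ.ne']
  rw [hweq] at key
  exact key.2

theorem exists_unit_separating (hC : IsClosed C) (hconv : Convex ℝ C) (hw : w ∉ C) :
    ∃ g : EuclideanSpace ℝ (Fin n), ‖g‖ = 1 ∧ ∀ y ∈ C, ⟪g, y⟫ ≤ ‖w‖ := by
  rcases C.eq_empty_or_nonempty with rfl | ⟨y₀, hy₀⟩
  · exact ⟨EuclideanSpace.single 0 1, by simp, by simp⟩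
  obtain ⟨f, u, hf, hu⟩ := geometric_hahn_banach_closed_point hconv hC hw
  set g := (InnerProductSpace.toDual ℝ (EuclideanSpace ℝ (Fin n))).symm f with hg
  have hgf : ∀ x, ⟪g, x⟫ = f x := fun x => InnerProductSpace.toDual_symm_apply
  have hg0 : g ≠ 0 := by
    intro h0
    have h1 := hf y₀ hy₀
    rw [← hgf, h0, inner_zero_left] at h1
    rw [← hgf, h0, inner_zero_left] at hu
    linarith
  have hgp : 0 < ‖g‖ := norm_pos_iff.mpr hg0
  refine ⟨‖g‖⁻¹ • g, by simp [norm_smul, hgp.ne'], fun y hy => ?_⟩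
  rw [inner_smul_left, conj_trivial, hgf, inv_mul_le_iff₀ hgp]
  calc f y ≤ f w := ((hf y hy).trans hu).le
    _ = ⟪g, w⟫ := (hgf w).symm
    _ ≤ _ := real_inner_le_norm g w

/-- The number of steps of the local search in dimension `n`. -/
noncomputable def localSteps (n : ℕ) : ℕ := ⌊512 * (n : ℝ) ^ 3 * Real.log n⌋₊ + 1

theorem localStep_queryBound (C : Set (EuclideanSpace ℝ (Fin n))) (t δ : ℝ)
    (w : EuclideanSpace ℝ (Fin n)) :
    QueryBound (2 * n + 1) (fun ψ => localStep C t δ (extendZero C ψ) w) := by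
  classical
  have h1 := QueryBound.extendZero_family C (fun j : Fin n × Bool => probe t w j)
  have h2 := h1.bind (h := fun v ψ => if (∀ j, probe t w j ∈ C) ∧
      extendZero C ψ w + 3 * δ ≤ v (argmax v) then probe t w (argmax v) else w)
    fun v => (QueryBound.extendZero C w).map fun r => if (∀ j, probe t w j ∈ C) ∧
      r + 3 * δ ≤ v (argmax v) then probe t w (argmax v) else w
  have hcard : Fintype.card (Fin n × Bool) = 2 * n := by simp [mul_comm]
  rw [hcard] at h2
  convert h2 using 2
  unfold localStep
  congr

theorem exists_shallow_cut (hC : IsClosed C) (hconv : Convex ℝ C) (hδ : 0 < δ) :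
    ∃ q : (C → ℝ) → EuclideanSpace ℝ (Fin n) × EuclideanSpace ℝ (Fin n),
      QueryBound (2 * n + localSteps n * (2 * n + 1)) q ∧
      ∀ F ψ, ConvexOn ℝ C F → IsZeroOrderOracle C F δ ψ → ‖(q ψ).1‖ = 1 ∧
        ∀ y ∈ C, ‖y‖ ≤ 1 → 1 / (8 * (n : ℝ)) < ⟪(q ψ).1, y⟫ →
          (q ψ).2 ∈ C ∧ F (q ψ).2 ≤ F y + 20480 * (n : ℝ) ^ 5 * δ := by
  classical
  have hn1 : (1 : ℝ) ≤ n := by exact_mod_cast NeZero.one_le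
  have hn0 : (0 : ℝ) < n := by linarith
  have hs1 : 1 ≤ √(n : ℝ) := Real.one_le_sqrt.mpr hn1
  have hs2 : √(n : ℝ) ^ 2 = n := Real.sq_sqrt hn0.le
  have hsn : √(n : ℝ) ≤ n := by nlinarith
  set ρ : ℝ := 1 / (16 * n) with hρ
  set β : ℝ := 1 / (8 * n) with hβ
  set t : ℝ := 1 / (16 * n * √n) with ht
  have hρ0 : 0 < ρ := by positivity
  have ht0 : 0 < t := by positivity
  have hρβ : ρ < β := by rw [hρ, hβ]; gcongr; norm_num
  have htβ : t * √n ≤ β - ρ := by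
    apply le_of_eq; rw [ht, hβ, hρ]; field_simp; norm_num
  have ht2 : t ^ 2 = 1 / (256 * n ^ 3) := by
    rw [ht, div_pow, mul_pow, mul_pow, hs2]; ring
  have ht2' : t ^ 2 ≤ 1 / 2 := by
    rw [ht2]
    gcongr
    nlinarith [one_le_pow₀ (n := 3) hn1]
  by_cases hcross : ∃ j, crossVertex (n := n) ρ j ∉ C
  · obtain ⟨j, hj⟩ := hcross
    obtain ⟨g, hg1, hg⟩ := exists_unit_separating hC hconv hj
    refine ⟨fun _ => (g, 0), QueryBound.const _ _, fun F ψ _ _ => ⟨hg1, fun y hy _ hlt => ?_⟩⟩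
    have := hg y hy
    rw [norm_crossVertex hρ0.le] at this
    simp only at hlt
    linarith
  push Not at hcross
  have hdir : ∀ w : EuclideanSpace ℝ (Fin n), ∃ g : EuclideanSpace ℝ (Fin n),
      w ≠ 0 → ‖w‖ ≤ ρ → ‖g‖ = 1 ∧ ((∀ j, probe t w j ∈ C) → g = ‖w‖⁻¹ • w) ∧
        ((¬ ∀ j, probe t w j ∈ C) → ∀ y ∈ C, ⟪g, y⟫ ≤ ρ) := by
    intro w
    by_cases hw : w ≠ 0 ∧ ‖w‖ ≤ ρ
    · obtain ⟨hw0, hwρ⟩ := hw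
      by_cases hp : ∀ j, probe t w j ∈ C
      · refine ⟨‖w‖⁻¹ • w, fun _ _ => ⟨?_, fun _ => rfl, fun h => absurd hp h⟩⟩
        simp [norm_smul, hw0]
      · obtain ⟨j, hj⟩ := not_forall.mp hp
        obtain ⟨g, hg1, hg⟩ := exists_unit_separating hC hconv hj
        refine ⟨g, fun _ _ => ⟨hg1, fun h => absurd h hp, fun _ y hy => (hg y hy).trans ?_⟩⟩
        refine le_trans ?_ hwρ
        refine (pow_le_pow_iff_left₀ (norm_nonneg _) (norm_nonneg _) two_ne_zero).mp ?_
        exact (norm_probe_sq_le ht2' hw0 j).trans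
          (mul_le_of_le_one_left (sq_nonneg _) (by nlinarith [sq_nonneg t]))
    · exact ⟨0, fun h1 h2 => absurd ⟨h1, h2⟩ hw⟩
  choose dir hdir using hdir
  let start : (EuclideanSpace ℝ (Fin n) → ℝ) → EuclideanSpace ℝ (Fin n) := fun h =>
    crossVertex ρ (argmax fun j => h (crossVertex ρ j))
  let final : (C → ℝ) → EuclideanSpace ℝ (Fin n) := fun ψ =>
    (localStep C t δ (extendZero C ψ))^[localSteps n] (start (extendZero C ψ))
  refine ⟨fun ψ => (dir (final ψ), final ψ), ?_, ?_⟩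
  · refine QueryBound.map (g := final) ?_ fun w => (dir w, w)
    have h1 := QueryBound.extendZero_family C (fun j : Fin n × Bool => crossVertex ρ j)
    rw [show Fintype.card (Fin n × Bool) = 2 * n by simp [mul_comm]] at h1
    exact h1.bind (h := fun v ψ =>
      (localStep C t δ (extendZero C ψ))^[localSteps n] (crossVertex ρ (argmax v)))
      fun v => QueryBound.iterate (fun s => localStep_queryBound C t δ s) _ _
  intro F ψ hF hψ
  have hh : ∀ x ∈ C, |extendZero C ψ x - F x| ≤ δ := fun x hx => by
    rw [extendZero_of_mem ψ hx]; exact hψ ⟨x, hx⟩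
  set h := extendZero C ψ with hhdef
  have hw0 : start h ≠ 0 := by
    rw [← norm_pos_iff, norm_crossVertex hρ0.le]; exact hρ0
  have hw0ρ : ‖start h‖ = ρ := norm_crossVertex hρ0.le _
  obtain ⟨f1, f2, f3, f4, f5⟩ := iterate_localStep (h := h) ht2' hδ (hcross _ : start h ∈ C) hw0
    (localSteps n)
  change final ψ ∈ C at f1
  change final ψ ≠ 0 at f2
  change ‖final ψ‖ ≤ _ at f3
  change final ψ = _ ∨ _ ≤ h (final ψ) at f4
  change localStep C t δ h (final ψ) = final ψ ∨ ‖final ψ‖ ^ 2 ≤ _ at f5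
  rw [hw0ρ] at f3 f5
  have hlow : ρ ≤ √n * ‖final ψ‖ := by
    rcases f4 with f4 | f4
    · rw [f4, hw0ρ]; nlinarith
    · by_contra hlt
      have hle := le_of_crossVertex_le (m := h (start h) + δ) hF hρ0 hcross (fun j => by
        have h1 := le_argmax (fun j => h (crossVertex (n := n) ρ j)) j
        have h2 := abs_le.mp (hh _ (hcross j))
        change h (crossVertex ρ j) ≤ h (start h) at h1
        linarith [h2.1]) (not_le.mp hlt).le
      have := abs_le.mp (hh _ f1)
      linarith [this.2]
  have hstall : localStep C t δ h (final ψ) = final ψ := by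
    refine f5.resolve_right fun hsmall => ?_
    have hx : Real.log n < t ^ 2 / 2 * localSteps n := by
      have := Nat.lt_floor_add_one (512 * (n : ℝ) ^ 3 * Real.log n)
      rw [ht2, localSteps]
      push_cast
      rw [div_div, one_div, ← div_eq_inv_mul, lt_div_iff₀ (by positivity)]
      linarith
    have hpow : (1 - t ^ 2 / 2) ^ localSteps n < 1 / n := by
      calc (1 - t ^ 2 / 2) ^ localSteps n ≤ Real.exp (-(t ^ 2 / 2)) ^ localSteps n := by
            gcongr
            · linarith
            · exact Real.one_sub_le_exp_neg _
        _ = Real.exp (-(t ^ 2 / 2 * localSteps n)) := by rw [← Real.exp_nat_mul]; ring_nf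
        _ < Real.exp (-Real.log n) := by gcongr
        _ = 1 / n := by rw [Real.exp_neg, Real.exp_log hn0, one_div]
    have h1 : ‖final ψ‖ ^ 2 < 1 / n * ρ ^ 2 := hsmall.trans_lt (by gcongr)
    have h2 : ρ ^ 2 ≤ (√n * ‖final ψ‖) ^ 2 := by gcongr
    rw [mul_pow, hs2] at h2
    have h3 : n * ‖final ψ‖ ^ 2 < n * (1 / n * ρ ^ 2) := by gcongr
    rw [← mul_assoc, mul_one_div_cancel hn0.ne', one_mul] at h3
    linarith
  obtain ⟨d1, d2, d3⟩ := hdir (final ψ) f2 f3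
  refine ⟨d1, fun y hyC hy hlt => ?_⟩
  simp only at hlt ⊢
  have hp : ∀ j, probe t (final ψ) j ∈ C := by
    by_contra hp
    linarith [d3 hp y hyC]
  rw [d2 hp] at hlt
  refine ⟨f1, ?_⟩
  have hle := le_of_probe_le (Nat.pos_of_neZero n) hF f2 (σ := 5 * δ) ht0 (by linarith) f3 hρβ htβ
    hp (fun j => by
      have h1 := lt_of_localStep_eq hδ hstall hp j
      have h2 := abs_le.mp (hh _ (hp j))
      have h3 := abs_le.mp (hh _ f1)
      linarith [h2.1, h3.2]) hyC hy hlt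
  refine hle.trans ?_
  gcongr
  have hfp : 0 < ‖final ψ‖ := norm_pos_iff.mpr f2
  have hnf : 1 / (16 * n) ≤ n * ‖final ψ‖ := hlow.trans (by gcongr)
  rw [div_le_iff₀ (by positivity), ht2]
  have : 20480 * (n : ℝ) ^ 5 * δ * (1 / (256 * n ^ 3) * ‖final ψ‖)
      = 80 * n * (n * ‖final ψ‖) * δ := by field_simp; norm_num
  rw [this]
  have h5 : 80 * n * (1 / (16 * n)) ≤ 80 * n * (n * ‖final ψ‖) := by gcongr
  have h6 : 80 * (n : ℝ) * (1 / (16 * n)) = 5 := by field_simp; norm_num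
  rw [h6] at h5
  gcongr

end LocalSearch

section Ellipsoid

variable {n : ℕ}

/-- The linear map that scales by `1 / a` along the unit vector `g` and by `1 / b` orthogonally. -/
noncomputable def axisScaling (a b : ℝ) (g : EuclideanSpace ℝ (Fin n)) :
    EuclideanSpace ℝ (Fin n) →ₗ[ℝ] EuclideanSpace ℝ (Fin n) :=
  b⁻¹ • LinearMap.transvection ((b / a - 1) • innerₗ (EuclideanSpace ℝ (Fin n)) g) g

theorem det_axisScaling {a b : ℝ} {g : EuclideanSpace ℝ (Fin n)} (hg : ‖g‖ = 1) :
    LinearMap.det (axisScaling a b g) = b⁻¹ ^ n * (b / a) := by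
  rw [axisScaling, LinearMap.det_smul, LinearMap.transvection.det]
  simp [hg]

theorem axisScaling_apply {a b : ℝ} {g u : EuclideanSpace ℝ (Fin n)} :
    axisScaling a b g u = b⁻¹ • (u + ((b / a - 1) * ⟪g, u⟫) • g) := by
  simp [axisScaling, LinearMap.transvection.apply]

theorem norm_axisScaling_sq {a b : ℝ} (ha : 0 < a) (hb : 0 < b) {g u : EuclideanSpace ℝ (Fin n)}
    (hg : ‖g‖ = 1) : ‖axisScaling a b g u‖ ^ 2 =
      (‖u‖ ^ 2 - ⟪g, u⟫ ^ 2) / b ^ 2 + ⟪g, u⟫ ^ 2 / a ^ 2 := by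
  rw [axisScaling_apply, norm_smul, mul_pow, norm_add_sq_real, inner_smul_right, norm_smul, hg,
    real_inner_comm g u]
  simp only [Real.norm_eq_abs, sq_abs, mul_pow]
  field_simp
  ring

/-- The inequality behind the inclusion of a shallow half ball in the next ellipsoid. -/
theorem shallow_cut_inequality {τ s U : ℝ} (hτ : 0 < τ) (hτ8 : τ ≤ 1 / 8) (hs : -1 ≤ s)
    (hsτ : s ≤ τ) (hU : U ≤ 1) :
    (U - s ^ 2) / (1 + 16 / 5 * τ ^ 2) ^ 2 + (s + τ) ^ 2 / (1 - τ) ^ 2 ≤ 1 := by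
  have h0 : 0 < 1 - τ := by linarith
  have h1 : 49 / 64 ≤ (1 - τ) ^ 2 := by nlinarith
  have h3 : τ ^ 2 ≤ 1 / 64 := by nlinarith
  set A := 1 / (1 - τ) ^ 2 with hA
  set D := 1 / (1 + 16 / 5 * τ ^ 2) ^ 2 with hD
  have hD0 : 0 ≤ D := by positivity
  have hA1 : A * (1 - τ) ^ 2 = 1 := by rw [hA]; field_simp
  have hA2 : A ≤ 64 / 49 := by
    rw [hA, div_le_iff₀ (by positivity)]; linarith
  have hA3 : 1 ≤ A := by
    rw [hA, le_div_iff₀ (by positivity)]; nlinarith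
  have hD1 : D ≤ 1 := by
    rw [hD, div_le_iff₀ (by positivity)]; nlinarith [sq_nonneg τ, sq_nonneg (τ ^ 2)]
  have hD2 : D ≤ 1 - 256 / 49 * τ ^ 2 := by
    rw [hD, div_le_iff₀ (by positivity)]
    have h4 : 1 + 32 / 5 * τ ^ 2 ≤ (1 + 16 / 5 * τ ^ 2) ^ 2 := by nlinarith [sq_nonneg (τ ^ 2)]
    have h5 : 1 ≤ (1 - 256 / 49 * τ ^ 2) * (1 + 32 / 5 * τ ^ 2) := by nlinarith [sq_nonneg τ]
    exact h5.trans (mul_le_mul_of_nonneg_left h4 (by linarith))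
  have hend : (1 - τ ^ 2) * D + 4 * τ ^ 2 * A ≤ 1 := by
    have h6 : 4 * τ ^ 2 * A ≤ 4 * τ ^ 2 * (64 / 49) := by gcongr
    have h7 : 0 ≤ τ ^ 2 * D := by positivity
    linarith
  have key : (U - s ^ 2) * D ≤ (1 - s ^ 2) * D := by gcongr
  rw [div_eq_mul_one_div, div_eq_mul_one_div ((s + τ) ^ 2), ← hA, ← hD]
  refine (add_le_add_left key _).trans ?_
  have e1 : (1 + τ) * (1 - ((1 - s ^ 2) * D + (s + τ) ^ 2 * A)) =
      (τ - s) * (1 - A * (1 - τ) ^ 2) + (s + 1) * (1 - ((1 - τ ^ 2) * D + 4 * τ ^ 2 * A))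
        + (1 + τ) * ((A - D) * ((s + 1) * (τ - s))) := by ring
  have e2 : 0 ≤ (1 + τ) * (1 - ((1 - s ^ 2) * D + (s + τ) ^ 2 * A)) := by
    rw [e1, hA1, sub_self, mul_zero, zero_add]
    have p1 : 0 ≤ (s + 1) * (1 - ((1 - τ ^ 2) * D + 4 * τ ^ 2 * A)) :=
      mul_nonneg (by linarith) (by linarith)
    have p2 : 0 ≤ (A - D) * ((s + 1) * (τ - s)) :=
      mul_nonneg (by linarith) (mul_nonneg (by linarith) (by linarith))
    have p3 := mul_nonneg (by linarith : 0 ≤ 1 + τ) p2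
    linarith
  linarith [nonneg_of_mul_nonneg_right e2 (by linarith : 0 < 1 + τ)]

theorem exists_ellipsoid_update [NeZero n] (c : EuclideanSpace ℝ (Fin n))
    (B : EuclideanSpace ℝ (Fin n) ≃ₗ[ℝ] EuclideanSpace ℝ (Fin n))
    (g : EuclideanSpace ℝ (Fin n)) (hg : ‖g‖ = 1) :
    ∃ (c' : EuclideanSpace ℝ (Fin n))
      (B' : EuclideanSpace ℝ (Fin n) ≃ₗ[ℝ] EuclideanSpace ℝ (Fin n)),
      Real.exp (3 / (40 * n)) * |LinearMap.det (B : EuclideanSpace ℝ (Fin n) →ₗ[ℝ] _)|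
        ≤ |LinearMap.det (B' : EuclideanSpace ℝ (Fin n) →ₗ[ℝ] _)| ∧
      ∀ x, ‖B (x - c)‖ ≤ 1 → ⟪g, B (x - c)⟫ ≤ 1 / (8 * n) → ‖B' (x - c')‖ ≤ 1 := by
  have hn1 : (1 : ℝ) ≤ n := by exact_mod_cast NeZero.one_le
  have hn0 : (0 : ℝ) < n := by linarith
  set τ : ℝ := 1 / (8 * n) with hτ
  have hτ0 : 0 < τ := by positivity
  have hτ8 : τ ≤ 1 / 8 := by
    rw [hτ]; gcongr; linarith
  have hnτ : (n : ℝ) = 1 / (8 * τ) := by rw [hτ]; field_simp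
  set a : ℝ := 1 - τ with ha
  set b : ℝ := 1 + 1 / (20 * n ^ 2) with hb
  have hbτ : b = 1 + 16 / 5 * τ ^ 2 := by rw [hb, hnτ]; field_simp; ring
  have ha0 : 0 < a := by linarith
  have hb0 : 0 < b := by positivity
  have hdet := det_axisScaling (a := a) (b := b) hg
  have hexp : Real.exp (3 / (40 * n)) ≤ b⁻¹ ^ n * (b / a) := by
    have h1 : b ^ n ≤ b * Real.exp (1 / (20 * n)) := by
      obtain ⟨m, hm⟩ : ∃ m, n = m + 1 := ⟨n - 1, by have := NeZero.pos n; omega⟩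
      calc b ^ n = b * b ^ m := by rw [hm, pow_succ']
        _ ≤ b * Real.exp (1 / (20 * n ^ 2)) ^ m := by
          gcongr
          rw [hb, add_comm]; exact Real.add_one_le_exp _
        _ = b * Real.exp (m * (1 / (20 * n ^ 2))) := by rw [Real.exp_nat_mul]
        _ ≤ b * Real.exp (1 / (20 * n)) := by
          gcongr
          have : (m : ℝ) ≤ n := by rw [hm]; push_cast; linarith
          calc (m : ℝ) * (1 / (20 * n ^ 2)) ≤ n * (1 / (20 * n ^ 2)) := by gcongr
            _ = _ := by field_simp
    have h2 : a ≤ Real.exp (-τ) := Real.one_sub_le_exp_neg τ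
    have h3 : Real.exp (3 / (40 * n)) * Real.exp (1 / (20 * n)) * Real.exp (-τ) = 1 := by
      rw [← Real.exp_add, ← Real.exp_add, Real.exp_eq_one_iff, hτ]
      field_simp; norm_num
    rw [inv_pow, ← div_eq_inv_mul, div_div, le_div_iff₀ (by positivity)]
    calc Real.exp (3 / (40 * n)) * (a * b ^ n)
        ≤ Real.exp (3 / (40 * n)) * (Real.exp (-τ) * (b * Real.exp (1 / (20 * n)))) := by gcongr
      _ = b * (Real.exp (3 / (40 * n)) * Real.exp (1 / (20 * n)) * Real.exp (-τ)) := by ring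
      _ = b := by rw [h3, mul_one]
  have hpos : 0 < LinearMap.det (axisScaling a b g) := by
    rw [hdet]; positivity
  set S := LinearMap.equivOfDetNeZero (axisScaling a b g) hpos.ne' with hS
  have hSapp : ∀ u, S u = axisScaling a b g u := fun u => rfl
  refine ⟨c - τ • B.symm g, B.trans S, ?_, fun x hx hgx => ?_⟩
  · have : ((B.trans S : EuclideanSpace ℝ (Fin n) ≃ₗ[ℝ] _) : EuclideanSpace ℝ (Fin n) →ₗ[ℝ] _)
        = axisScaling a b g ∘ₗ (B : EuclideanSpace ℝ (Fin n) →ₗ[ℝ] _) := by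
      ext1 u; rfl
    rw [this, LinearMap.det_comp, abs_mul, abs_of_pos hpos, hdet]
    gcongr
  · have hBx : B (x - (c - τ • B.symm g)) = B (x - c) + τ • g := by
      rw [← sub_add, map_add, map_smul, LinearEquiv.apply_symm_apply]
    rw [LinearEquiv.trans_apply, hBx, hSapp]
    set u := B (x - c) with hu
    set s := ⟪g, u⟫ with hs
    have hs1 : -1 ≤ s := by
      have := (abs_le.mp (abs_real_inner_le_norm g u)).1
      rw [hg, one_mul] at this
      linarith
    have hgu : ⟪g, u + τ • g⟫ = s + τ := by
      rw [inner_add_right, inner_smul_right, real_inner_self_eq_norm_sq, hg]; ring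
    have hnu : ‖u + τ • g‖ ^ 2 - (s + τ) ^ 2 = ‖u‖ ^ 2 - s ^ 2 := by
      rw [norm_add_sq_real, inner_smul_right, real_inner_comm g u, norm_smul, hg,
        Real.norm_of_nonneg hτ0.le]
      ring
    have hu1 : ‖u‖ ^ 2 ≤ 1 := by nlinarith [norm_nonneg u]
    refine (sq_le_one_iff₀ (norm_nonneg _)).mp ?_
    rw [norm_axisScaling_sq ha0 hb0 hg, hgu, hnu]
    rw [hbτ]
    exact shallow_cut_inequality hτ0 hτ8 hs1 hgx hu1

end Ellipsoid

section Ellipsoid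

variable {n : ℕ} [NeZero n] {C : Set (EuclideanSpace ℝ (Fin n))} {δ : ℝ}

/-- The number of queries used for one shallow cut in dimension `n`. -/
noncomputable def cutQueries (n : ℕ) : ℕ := 2 * n + localSteps n * (2 * n + 1)

theorem exists_ellipsoid_cut (hC : IsClosed C) (hconv : Convex ℝ C) (hδ : 0 < δ)
    (c : EuclideanSpace ℝ (Fin n))
    (B : EuclideanSpace ℝ (Fin n) ≃ₗ[ℝ] EuclideanSpace ℝ (Fin n)) :
    ∃ q : (C → ℝ) → EuclideanSpace ℝ (Fin n) × EuclideanSpace ℝ (Fin n),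
      QueryBound (cutQueries n) q ∧
      ∀ F ψ, ConvexOn ℝ C F → IsZeroOrderOracle C F δ ψ → ‖(q ψ).1‖ = 1 ∧
        ∀ y ∈ C, ‖B (y - c)‖ ≤ 1 → 1 / (8 * (n : ℝ)) < ⟪(q ψ).1, B (y - c)⟫ →
          (q ψ).2 ∈ C ∧ F (q ψ).2 ≤ F y + 20480 * (n : ℝ) ^ 5 * δ := by
  let φ : EuclideanSpace ℝ (Fin n) →ᵃ[ℝ] EuclideanSpace ℝ (Fin n) :=
    (B.symm : EuclideanSpace ℝ (Fin n) →ₗ[ℝ] _).toAffineMap + AffineMap.const ℝ _ c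
  have hφ : ∀ w, φ w = B.symm w + c := fun w => rfl
  have hφB : ∀ y, φ (B (y - c)) = y := fun y => by simp [hφ]
  have hcont : Continuous φ := AffineMap.continuous_of_finiteDimensional φ
  obtain ⟨q, hq, hspec⟩ := exists_shallow_cut (C := φ ⁻¹' C) (hC.preimage hcont)
    (hconv.affine_preimage φ) hδ
  let ι : φ ⁻¹' C → C := fun w => ⟨φ w, w.2⟩
  refine ⟨fun ψ => ((q (ψ ∘ ι)).1, φ (q (ψ ∘ ι)).2),
    (hq.comap ι).map fun r => (r.1, φ r.2), fun F ψ hF hψ => ?_⟩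
  obtain ⟨h1, h2⟩ := hspec (F ∘ φ) (ψ ∘ ι) (hF.comp_affineMap φ) fun w => hψ (ι w)
  refine ⟨h1, fun y hyC hy hlt => ?_⟩
  have := h2 (B (y - c)) (by rw [Set.mem_preimage, hφB]; exact hyC) hy hlt
  simpa only [Function.comp, hφB, Set.mem_preimage] using this

/-- The state of the ellipsoid method: the center `c` and the linear map `B` of the current
ellipsoid `‖B (x - c)‖ ≤ 1`, and the best point found so far. -/
abbrev EllipsoidState (n : ℕ) : Type :=
  EuclideanSpace ℝ (Fin n) × (EuclideanSpace ℝ (Fin n) ≃ₗ[ℝ] EuclideanSpace ℝ (Fin n)) ×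
    EuclideanSpace ℝ (Fin n)

/-- Membership in the current ellipsoid. -/
def EllipsoidState.Contains (s : EllipsoidState n) (y : EuclideanSpace ℝ (Fin n)) : Prop :=
  ‖s.2.1 (y - s.1)‖ ≤ 1

/-- The inverse of the volume of the current ellipsoid, relative to the unit ball. -/
noncomputable def EllipsoidState.absDet (s : EllipsoidState n) : ℝ :=
  |LinearMap.det (s.2.1 : EuclideanSpace ℝ (Fin n) →ₗ[ℝ] EuclideanSpace ℝ (Fin n))|

theorem exists_ellipsoid_round (hC : IsClosed C) (hconv : Convex ℝ C) (hδ : 0 < δ)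
    (s : EllipsoidState n) :
    ∃ q : (C → ℝ) → EllipsoidState n, QueryBound (cutQueries n + 2) q ∧
      ∀ F ψ, ConvexOn ℝ C F → IsZeroOrderOracle C F δ ψ → s.2.2 ∈ C →
        (q ψ).2.2 ∈ C ∧ Real.exp (3 / (40 * n)) * s.absDet ≤ (q ψ).absDet ∧
        extendZero C ψ (q ψ).2.2 ≤ extendZero C ψ s.2.2 ∧
        ∀ y ∈ C, s.Contains y → (q ψ).Contains y ∨
          extendZero C ψ (q ψ).2.2 ≤ F y + (20480 * (n : ℝ) ^ 5 + 1) * δ := by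
  classical
  obtain ⟨c, B, x⟩ := s
  obtain ⟨q, hq, hspec⟩ := exists_ellipsoid_cut hC hconv hδ c B
  have hup : ∀ g : EuclideanSpace ℝ (Fin n), ∃ (p : EuclideanSpace ℝ (Fin n) ×
      (EuclideanSpace ℝ (Fin n) ≃ₗ[ℝ] EuclideanSpace ℝ (Fin n))), ‖g‖ = 1 →
      Real.exp (3 / (40 * n)) * |LinearMap.det (B : EuclideanSpace ℝ (Fin n) →ₗ[ℝ] _)|
        ≤ |LinearMap.det (p.2 : EuclideanSpace ℝ (Fin n) →ₗ[ℝ] _)| ∧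
      ∀ x, ‖B (x - c)‖ ≤ 1 → ⟪g, B (x - c)⟫ ≤ 1 / (8 * n) → ‖p.2 (x - p.1)‖ ≤ 1 := by
    intro g
    by_cases hg : ‖g‖ = 1
    · obtain ⟨c', B', h1, h2⟩ := exists_ellipsoid_update c B g hg
      exact ⟨(c', B'), fun _ => ⟨h1, h2⟩⟩
    · exact ⟨(c, B), fun h => absurd h hg⟩
  choose up hup using hup
  let best : (EuclideanSpace ℝ (Fin n) × EuclideanSpace ℝ (Fin n)) → ℝ → ℝ → EllipsoidState n :=
    fun r a b => ((up r.1).1, (up r.1).2, if r.2 ∈ C ∧ a < b then r.2 else x)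
  refine ⟨fun ψ => best (q ψ) (extendZero C ψ (q ψ).2) (extendZero C ψ x), ?_, ?_⟩
  · refine hq.bind (h := fun r ψ => best r (extendZero C ψ r.2) (extendZero C ψ x)) fun r => ?_
    exact (QueryBound.extendZero C r.2).bind (n := 1) (m := 1)
      (h := fun a ψ => best r a (extendZero C ψ x))
      fun a => (QueryBound.extendZero C x).map fun b => best r a b
  intro F ψ hF hψ hx
  obtain ⟨h1, h2⟩ := hspec F ψ hF hψ
  obtain ⟨u1, u2⟩ := hup (q ψ).1 h1
  have hbest : ∀ P : EuclideanSpace ℝ (Fin n) → Prop,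
      ((q ψ).2 ∈ C → extendZero C ψ (q ψ).2 < extendZero C ψ x → P (q ψ).2) →
      (¬ ((q ψ).2 ∈ C ∧ extendZero C ψ (q ψ).2 < extendZero C ψ x) → P x) →
      P (best (q ψ) (extendZero C ψ (q ψ).2) (extendZero C ψ x)).2.2 := by
    intro P hP1 hP2
    simp only [best]
    split_ifs with hc
    · exact hP1 hc.1 hc.2
    · exact hP2 hc
  refine ⟨hbest (· ∈ C) (fun h _ => h) fun _ => hx, u1,
    hbest (fun v => extendZero C ψ v ≤ extendZero C ψ x) (fun _ h => h.le) fun _ => le_rfl,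
    fun y hyC hy => ?_⟩
  by_cases hlt : ⟪(q ψ).1, B (y - c)⟫ ≤ 1 / (8 * n)
  · exact Or.inl (u2 y hy hlt)
  right
  obtain ⟨hv, hFv⟩ := h2 y hyC hy (not_le.mp hlt)
  have hle : extendZero C ψ (q ψ).2 ≤ F (q ψ).2 + δ := by
    rw [extendZero_of_mem ψ hv]
    linarith [(abs_le.mp (hψ ⟨_, hv⟩)).2]
  refine hbest (fun v => extendZero C ψ v ≤ F y + (20480 * (n : ℝ) ^ 5 + 1) * δ) ?_ ?_
  · intro _ _; linarith
  · intro hc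
    have : extendZero C ψ x ≤ extendZero C ψ (q ψ).2 := by
      by_contra hcc; exact hc ⟨hv, not_le.mp hcc⟩
    linarith

theorem abs_det_le_of_norm_le (B : EuclideanSpace ℝ (Fin n) →ₗ[ℝ] EuclideanSpace ℝ (Fin n))
    {K : ℝ} (hB : ∀ i, ‖B (EuclideanSpace.single i 1)‖ ≤ K) :
    |LinearMap.det B| ≤ (n : ℝ) ^ n * K ^ n := by
  have hK : 0 ≤ K := (norm_nonneg _).trans (hB 0)
  have h := Matrix.det_le (A := LinearMap.toMatrix (EuclideanSpace.basisFun (Fin n) ℝ).toBasis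
    (EuclideanSpace.basisFun (Fin n) ℝ).toBasis B) (abv := AbsoluteValue.abs) (x := K) (by
      intro i j
      rw [LinearMap.toMatrix_apply]
      simp only [OrthonormalBasis.coe_toBasis, EuclideanSpace.basisFun_apply,
        OrthonormalBasis.coe_toBasis_repr_apply, EuclideanSpace.basisFun_repr]
      refine le_trans ?_ (hB j)
      exact PiLp.norm_apply_le (B (EuclideanSpace.single j 1)) i)
  rw [LinearMap.det_toMatrix] at h
  simp only [Fintype.card_fin, nsmul_eq_mul] at h
  refine h.trans ?_
  gcongr
  exact_mod_cast Nat.factorial_le_pow n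

/-- The number of rounds of the ellipsoid method in dimension `n` if the range of the function
is `R` times the desired accuracy. -/
noncomputable def ellipsoidRounds (n : ℕ) (R : ℝ) : ℕ :=
  ⌊40 / 3 * (n : ℝ) ^ 2 * (2 * Real.log n + Real.log (4 * R))⌋₊ + 1

theorem exists_convex_minimization (hC : IsClosed C) (hconv : Convex ℝ C) (h0 : 0 ∈ C)
    (he : ∀ i, EuclideanSpace.single i 1 ∈ C) (hbox : ∀ x ∈ C, ∀ i, |x i| ≤ 1) {M ε : ℝ}
    (hδ : 0 < δ) (hε : 0 < ε) (hεM : ε ≤ M) (hδε : (20480 * (n : ℝ) ^ 5 + 2) * δ ≤ ε / 2) :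
    ∃ q : (C → ℝ) → C, QueryBound (ellipsoidRounds n (M / ε) * (cutQueries n + 2)) q ∧
      ∀ F ψ, ConvexOn ℝ C F → (∀ x ∈ C, ∀ y ∈ C, F x - F y ≤ M) → IsZeroOrderOracle C F δ ψ →
        ∀ x ∈ C, F (q ψ) ≤ F x + ε := by
  classical
  have hn1 : (1 : ℝ) ≤ n := by exact_mod_cast NeZero.one_le
  have hn0 : (0 : ℝ) < n := by linarith
  choose step hstep hspec using exists_ellipsoid_round (n := n) hC hconv hδ
  let s₀ : EllipsoidState n := (0, LinearEquiv.smulOfNeZero ℝ _ (n : ℝ)⁻¹ (by positivity), 0)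
  set J := ellipsoidRounds n (M / ε) with hJ
  let final : (C → ℝ) → EllipsoidState n := fun ψ => (fun s => step s ψ)^[J] s₀
  have hfinal : QueryBound (J * (cutQueries n + 2)) final :=
    QueryBound.iterate (step := fun ψ s => step s ψ) hstep J s₀
  refine ⟨fun ψ => if h : (final ψ).2.2 ∈ C then ⟨_, h⟩ else ⟨0, h0⟩,
    hfinal.map (β := C) fun s => if h : s.2.2 ∈ C then ⟨_, h⟩ else ⟨0, h0⟩, fun F ψ hF hM hψ x hx => ?_⟩
  have hdet₀ : s₀.absDet = ((n : ℝ) ^ n)⁻¹ := by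
    have : ((s₀.2.1 : EuclideanSpace ℝ (Fin n) ≃ₗ[ℝ] _) :
        EuclideanSpace ℝ (Fin n) →ₗ[ℝ] EuclideanSpace ℝ (Fin n))
        = (n : ℝ)⁻¹ • LinearMap.id := by ext1 u; rfl
    rw [EllipsoidState.absDet, this, LinearMap.det_smul, LinearMap.det_id, mul_one,
      finrank_euclideanSpace_fin, inv_pow, abs_of_pos (by positivity)]
  have hcont₀ : ∀ y ∈ C, s₀.Contains y := by
    intro y hy
    have hyn : ‖y‖ ≤ n := by
      rw [EuclideanSpace.norm_eq]
      refine Real.sqrt_le_iff.mpr ⟨hn0.le, ?_⟩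
      calc ∑ i, ‖y i‖ ^ 2 ≤ ∑ _i : Fin n, (1 : ℝ) := by
            refine Finset.sum_le_sum fun i _ => ?_
            rw [Real.norm_eq_abs]
            exact pow_le_one₀ (abs_nonneg _) (hbox y hy i)
        _ = n := by simp
        _ ≤ (n : ℝ) ^ 2 := by nlinarith
    change ‖(n : ℝ)⁻¹ • (y - 0)‖ ≤ 1
    rw [sub_zero, norm_smul, norm_inv, Real.norm_of_nonneg hn0.le, inv_mul_le_iff₀ hn0]
    linarith
  have inv : ∀ k : ℕ, ((fun s => step s ψ)^[k] s₀).2.2 ∈ C ∧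
      Real.exp (3 / (40 * n)) ^ k * ((n : ℝ) ^ n)⁻¹ ≤ ((fun s => step s ψ)^[k] s₀).absDet ∧
      ∀ y ∈ C, ((fun s => step s ψ)^[k] s₀).Contains y ∨
        extendZero C ψ ((fun s => step s ψ)^[k] s₀).2.2
          ≤ F y + (20480 * (n : ℝ) ^ 5 + 1) * δ := by
    intro k
    induction k with
    | zero => exact ⟨h0, by simp [hdet₀], fun y hy => Or.inl (hcont₀ y hy)⟩
    | succ k ih =>
      rw [Function.iterate_succ_apply']
      obtain ⟨i1, i2, i3⟩ := ih
      obtain ⟨r1, r2, r3, r4⟩ := hspec ((fun s => step s ψ)^[k] s₀) F ψ hF hψ i1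
      refine ⟨r1, ?_, fun y hy => ?_⟩
      · refine le_trans ?_ r2
        rw [pow_succ', mul_assoc]
        gcongr
      · rcases i3 y hy with h | h
        · exact r4 y hy h
        · exact Or.inr (r3.trans h)
  obtain ⟨i1, i2, i3⟩ := inv J
  change (final ψ).2.2 ∈ C at i1
  change _ ≤ (final ψ).absDet at i2
  change ∀ y ∈ C, (final ψ).Contains y ∨ extendZero C ψ (final ψ).2.2 ≤ _ at i3
  simp only [dif_pos i1]
  have hM0 : 0 < M := by linarith
  set θ : ℝ := ε / (2 * M) with hθ
  have hθ0 : 0 < θ := by positivity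
  have hθ1 : θ ≤ 1 := by rw [hθ, div_le_one (by positivity)]; linarith
  have hmem : ∀ p ∈ C, (1 - θ) • x + θ • p ∈ C := fun p hp =>
    hconv hx hp (by linarith) hθ0.le (by ring)
  have hval : ∀ p ∈ C, F ((1 - θ) • x + θ • p) ≤ F x + ε / 2 := by
    intro p hp
    have h1 := hF.2 hx hp (by linarith : 0 ≤ 1 - θ) hθ0.le (by ring)
    have h2 : θ * (F p - F x) ≤ θ * M := by gcongr; exact hM p hp x hx
    have h3 : θ * M = ε / 2 := by rw [hθ]; field_simp
    simp only [smul_eq_mul] at h1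
    linarith
  have hgood : ∀ p ∈ C, extendZero C ψ (final ψ).2.2
        ≤ F ((1 - θ) • x + θ • p) + (20480 * (n : ℝ) ^ 5 + 1) * δ → F (final ψ).2.2 ≤ F x + ε := by
    intro p hp h
    have h1 := (abs_le.mp (hψ ⟨_, i1⟩)).1
    rw [extendZero_of_mem ψ i1] at h
    have h2 := hval p hp
    simp only at h1
    linarith
  by_contra hcon
  have hall : ∀ p ∈ C, (final ψ).Contains ((1 - θ) • x + θ • p) := fun p hp =>
    (i3 _ (hmem p hp)).resolve_right fun h => hcon (hgood p hp h)
  set B := (final ψ).2.1 with hB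
  have hBe : ∀ i, ‖(B : EuclideanSpace ℝ (Fin n) →ₗ[ℝ] EuclideanSpace ℝ (Fin n))
      (EuclideanSpace.single i 1)‖ ≤ 2 / θ := by
    intro i
    have h1 := hall _ (he i)
    have h2 := hall _ h0
    have h3 : B ((1 - θ) • x + θ • EuclideanSpace.single i 1 - (final ψ).1)
        - B ((1 - θ) • x + θ • 0 - (final ψ).1) = θ • B (EuclideanSpace.single i 1) := by
      rw [← map_sub, ← map_smul]
      congr 1
      module
    have h4 : ‖θ • B (EuclideanSpace.single i 1)‖ ≤ 1 + 1 := by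
      rw [← h3]; exact (norm_sub_le _ _).trans (add_le_add h1 h2)
    rw [norm_smul, Real.norm_of_nonneg hθ0.le] at h4
    rw [le_div_iff₀ hθ0]
    change ‖B (EuclideanSpace.single i 1)‖ * θ ≤ 2
    linarith
  have hdet := i2.trans (abs_det_le_of_norm_le _ hBe)
  have h2θ : 2 / θ = 4 * (M / ε) := by rw [hθ]; field_simp; norm_num
  have hRpos : 0 < 4 * (M / ε) := by positivity
  rw [h2θ, ← div_eq_mul_inv, div_le_iff₀ (by positivity), ← Real.exp_nat_mul] at hdet
  have hlog := Real.log_le_log (Real.exp_pos _) hdet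
  rw [Real.log_exp, Real.log_mul (by positivity) (by positivity),
    Real.log_mul (by positivity) (by positivity), Real.log_pow, Real.log_pow] at hlog
  have hJlt : 40 / 3 * (n : ℝ) ^ 2 * (2 * Real.log n + Real.log (4 * (M / ε))) < J := by
    rw [hJ, ellipsoidRounds]
    push_cast
    exact Nat.lt_floor_add_one _
  have h5 : J * (3 / (40 * (n : ℝ))) * (40 * n / 3) = J := by field_simp
  have h6 : J * (3 / (40 * (n : ℝ))) * (40 * n / 3) ≤
      (n * Real.log n + n * Real.log (4 * (M / ε)) + n * Real.log n) * (40 * n / 3) := by gcongr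
  rw [h5] at h6
  nlinarith

end Ellipsoid

section Coordinates

variable {W : Type*} [NormedAddCommGroup W] [NormedSpace ℝ W] [FiniteDimensional ℝ W]

theorem exists_basis_coord_abs_le_one {D : Set W} (hD : IsCompact D) (h0 : 0 ∈ D)
    (hspan : Submodule.span ℝ D = ⊤) :
    ∃ b : Module.Basis (Fin (Module.finrank ℝ W)) ℝ W,
      (∀ i, b i ∈ D) ∧ ∀ x ∈ D, ∀ i, |b.repr x i| ≤ 1 := by
  set b₀ := Module.finBasis ℝ W with hb₀
  have hcont : Continuous fun x : Fin (Module.finrank ℝ W) → W => |b₀.det x| := by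
    refine continuous_abs.comp (?_ : Continuous fun x => b₀.det x)
    simp only [Module.Basis.det_apply]
    refine Continuous.matrix_det (continuous_matrix fun i j => ?_)
    simp only [Module.Basis.toMatrix_apply]
    exact (LinearMap.continuous_of_finiteDimensional (b₀.coord i)).comp (continuous_apply j)
  obtain ⟨x, hxD, hmax⟩ := (isCompact_univ_pi fun _ : Fin (Module.finrank ℝ W) => hD).exists_isMaxOn
    ⟨fun _ => 0, fun _ _ => h0⟩ hcont.continuousOn
  have hpos : 0 < |b₀.det x| := by
    let b₁ := Module.Basis.ofSpan hspan.ge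
    have hfin := Module.Finite.finite_basis b₁
    have hcard := Module.finrank_eq_nat_card_basis b₁
    let b₂ := b₁.reindex (Finite.equivFinOfCardEq hcard.symm)
    have hb₂ : ∀ i, b₂ i ∈ D := fun i => by
      have hsub := Module.Basis.ofSpan_subset hspan.ge
      apply hsub
      simp only [b₂, Module.Basis.reindex_apply]
      exact Set.mem_range_self _
    have h1 : |b₀.det b₂| ≤ |b₀.det x| := hmax (a := ⇑b₂) fun i _ => hb₂ i
    exact (abs_pos.mpr (b₀.isUnit_det b₂).ne_zero).trans_le h1
  have hbasis := (Module.Basis.is_basis_iff_det b₀ (v := x)).mpr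
    (isUnit_iff_ne_zero.mpr (abs_pos.mp hpos))
  let b := Module.Basis.mk hbasis.1 hbasis.2.ge
  have hbx : ∀ i, b i = x i := fun i => by simp [b]
  refine ⟨b, fun i => by rw [hbx]; exact hxD i trivial, fun y hy i => ?_⟩
  have hdet : b₀.det (Function.update x i y) = b.repr y i * b₀.det x := by
    conv_lhs => rw [← b.sum_repr y]
    rw [AlternatingMap.map_update_sum, Finset.sum_eq_single i]
    · rw [AlternatingMap.map_update_smul, hbx, Function.update_eq_self, smul_eq_mul]
    · intro j _ hj
      rw [AlternatingMap.map_update_smul, hbx, AlternatingMap.map_update_self _ _ hj.symm,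
        smul_zero]
    · simp
  have hle : |b₀.det (Function.update x i y)| ≤ |b₀.det x| := by
    refine hmax (a := Function.update x i y) fun j _ => ?_
    by_cases hj : j = i
    · subst hj; simpa using hy
    · simpa [Function.update_of_ne hj] using hxD j trivial
  rw [hdet, abs_mul] at hle
  exact le_of_mul_le_mul_right (by simpa using hle) hpos

theorem exists_coordinates {C : Set W} (hC : IsCompact C) {p : W} (hp : p ∈ C) :
    ∃ n ≤ Module.finrank ℝ W, ∃ L : EuclideanSpace ℝ (Fin n) →ₗ[ℝ] W,
      (∀ i, L (EuclideanSpace.single i 1) + p ∈ C) ∧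
      (∀ y, L y + p ∈ C → ∀ i, |y i| ≤ 1) ∧ ∀ x ∈ C, ∃ y, L y + p = x := by
  set D : Set W := (fun v => v + p) ⁻¹' C with hD
  set U := Submodule.span ℝ D with hU
  have hDc : IsCompact D := (Homeomorph.addRight p).isClosedEmbedding.isCompact_preimage hC
  have hD' : IsCompact ((↑) ⁻¹' D : Set U) :=
    U.closed_of_finiteDimensional.isClosedEmbedding_subtypeVal.isCompact_preimage hDc
  obtain ⟨b, hb1, hb2⟩ := exists_basis_coord_abs_le_one hD' (by simpa [hD] using hp)
    (Submodule.span_span_coe_preimage)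
  let T : EuclideanSpace ℝ (Fin (Module.finrank ℝ U)) ≃ₗ[ℝ] U :=
    (WithLp.linearEquiv 2 ℝ _).trans b.equivFun.symm
  have hT : ∀ y i, b.repr (T y) i = y i := fun y i => by
    have : b.equivFun (T y) = WithLp.linearEquiv 2 ℝ _ y :=
      b.equivFun.apply_symm_apply _
    exact congrFun this i
  refine ⟨Module.finrank ℝ U, Submodule.finrank_le U, U.subtype ∘ₗ (T : _ →ₗ[ℝ] U), fun i => ?_,
    fun y hy i => ?_, fun x hx => ?_⟩
  · have : T (EuclideanSpace.single i 1) = b i := by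
      apply b.repr.injective
      ext j
      rw [hT, b.repr_self]
      simp [Finsupp.single_apply, eq_comm]
    have h2 := hb1 i
    rw [← this] at h2
    exact h2
  · rw [← hT y i]
    exact hb2 (T y) hy i
  · have hxU : x - p ∈ U := Submodule.subset_span (by simpa [hD] using hx)
    exact ⟨T.symm ⟨x - p, hxU⟩, by simp⟩

end Coordinates

theorem single_one_nonneg {E : Type*} [DecidableEq E] (e e' : E) :
    (0 : ℝ) ≤ (Pi.single e 1 : E → ℝ) e' := by
  rw [Pi.single_apply]; split_ifs <;> norm_num

theorem edgeFlow_nonneg {E : Type*} {k : ℕ} {f : Fin k → E → ℝ} (hf : ∀ i e, 0 ≤ f i e) (e : E) :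
    0 ≤ edgeFlow f e :=
  Finset.sum_nonneg fun i _ => hf i e

section Flow

variable {V E : Type*} [Fintype E] [DecidableEq V]

/-- The flow out of `v` minus the flow into `v`. -/
noncomputable def netOut (tail head : E → V) (f : E → ℝ) (v : V) : ℝ :=
  (∑ e with tail e = v, f e) - ∑ e with head e = v, f e

variable (tail head : E → V)

theorem netOut_add (f g : E → ℝ) (v : V) :
    netOut tail head (f + g) v = netOut tail head f v + netOut tail head g v := by
  simp only [netOut, Pi.add_apply, Finset.sum_add_distrib]; ring

theorem netOut_smul (a : ℝ) (f : E → ℝ) (v : V) :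
    netOut tail head (a • f) v = a * netOut tail head f v := by
  simp only [netOut, Pi.smul_apply, smul_eq_mul, ← Finset.mul_sum]; ring

theorem netOut_single [DecidableEq E] (e : E) (v : V) : netOut tail head (Pi.single e 1) v =
    (if v = tail e then 1 else 0) - (if v = head e then 1 else 0) := by
  simp [netOut, Pi.single_apply, eq_comm]

theorem continuous_netOut (v : V) : Continuous fun f : E → ℝ => netOut tail head f v := by
  unfold netOut; fun_prop

variable {tail head}

theorem exists_path_flow {f : E → ℝ} {a b : V}
    (h : Relation.ReflTransGen (fun x y => ∃ e, 0 < f e ∧ tail e = x ∧ head e = y) a b) :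
    ∃ χ : E → ℝ, (∀ e, 0 ≤ χ e) ∧ (∀ e, χ e ≠ 0 → 0 < f e) ∧
      ∀ v, netOut tail head χ v = (if v = a then 1 else 0) - (if v = b then 1 else 0) := by
  classical
  induction h with
  | refl => exact ⟨0, fun _ => le_rfl, fun _ h => absurd rfl h, fun v => by simp [netOut]⟩
  | @tail b c _ hbc ih =>
    obtain ⟨χ, h1, h2, h3⟩ := ih
    obtain ⟨e, he, rfl, rfl⟩ := hbc
    refine ⟨χ + Pi.single e 1, fun e' => ?_, fun e' h => ?_, fun v => ?_⟩
    · exact add_nonneg (h1 e') (single_one_nonneg e e')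
    · by_cases hee : e' = e
      · rw [hee]; exact he
      · exact h2 e' (by simpa [hee] using h)
    · rw [netOut_add, h3, netOut_single]; ring

theorem sum_netOut [Fintype V] (f : E → ℝ) (S : Finset V) :
    ∑ v ∈ S, netOut tail head f v =
      ∑ e, ((if tail e ∈ S then f e else 0) - (if head e ∈ S then f e else 0)) := by
  simp only [netOut, Finset.sum_sub_distrib, Finset.sum_filter]
  congr 1
  · rw [Finset.sum_comm]; simp
  · rw [Finset.sum_comm]; simp

/-- Below every flow of value `d` there is one that uses no edge for more than `d`. -/
theorem exists_flow_le_demand [Fintype V] {s t : V} {d : ℝ} (hd : 0 ≤ d) {g : E → ℝ}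
    (hg : ∀ e, 0 ≤ g e)
    (hgv : ∀ v, netOut tail head g v = (if v = s then d else 0) - (if v = t then d else 0)) :
    ∃ f : E → ℝ, (∀ e, 0 ≤ f e) ∧ (∀ e, f e ≤ g e) ∧ (∀ e, f e ≤ d) ∧
      ∀ v, netOut tail head f v = (if v = s then d else 0) - (if v = t then d else 0) := by
  classical
  set Q : Set (E → ℝ) := Set.Icc 0 g ∩ {f | ∀ v, netOut tail head f v =
    (if v = s then d else 0) - (if v = t then d else 0)} with hQ
  have hQc : IsCompact Q := by
    refine isCompact_Icc.inter_right ?_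
    simp only [Set.ofPred_forall]
    exact isClosed_iInter fun v => isClosed_eq (continuous_netOut tail head v) continuous_const
  obtain ⟨f, ⟨⟨hf0, hfg⟩, hfv⟩, hmin⟩ := hQc.exists_isMinOn (f := fun f : E → ℝ => ∑ e, f e)
    ⟨g, ⟨hg, le_rfl⟩, hgv⟩ (by fun_prop)
  refine ⟨f, hf0, hfg, fun e₀ => ?_, hfv⟩
  by_contra hlt
  have hfe₀ : 0 < f e₀ := hd.trans_lt (not_le.mp hlt)
  by_cases hreach : Relation.ReflTransGen (fun x y => ∃ e, 0 < f e ∧ tail e = x ∧ head e = y)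
      (head e₀) (tail e₀)
  · obtain ⟨χ, h1, h2, h3⟩ := exists_path_flow hreach
    set χ' := χ + Pi.single e₀ 1 with hχ'
    have hχ0 : ∀ e, 0 ≤ χ' e := fun e =>
      add_nonneg (h1 e) (single_one_nonneg e₀ e)
    have hχ1 : 1 ≤ χ' e₀ := by simpa [hχ'] using h1 e₀
    have hχv : ∀ v, netOut tail head χ' v = 0 := fun v => by
      rw [hχ', netOut_add, h3, netOut_single]; ring
    have hev : ∀ᶠ η : ℝ in nhdsWithin 0 (Set.Ioi 0), ∀ e, η * χ' e ≤ f e := by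
      rw [Filter.eventually_all]
      intro e
      rcases (hf0 e).lt_or_eq with hpos | hzero
      · have htend : Filter.Tendsto (fun η : ℝ => η * χ' e) (nhdsWithin 0 (Set.Ioi 0))
            (nhds 0) := by
          have : Filter.Tendsto (fun η : ℝ => η * χ' e) (nhds 0) (nhds (0 * χ' e)) :=
            (continuous_id.mul continuous_const).tendsto 0
          rw [zero_mul] at this
          exact this.mono_left nhdsWithin_le_nhds
        exact (htend.eventually_lt_const hpos).mono fun η h => h.le
      · have hne : e ≠ e₀ := by rintro rfl; exact hfe₀.ne hzero
        have hχe : χ e = 0 := by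
          by_contra hne0; exact (h2 e hne0).ne hzero
        refine Filter.Eventually.of_forall fun η => ?_
        simp [hχ', hχe, hne, ← hzero]
    obtain ⟨η, hη, hηpos⟩ := (hev.and self_mem_nhdsWithin).exists
    have hηpos : 0 < η := hηpos
    have hmem : f + (-η) • χ' ∈ Q := by
      refine ⟨⟨fun e => ?_, fun e => ?_⟩, fun v => ?_⟩
      · have := hη e
        simp only [Pi.zero_apply, Pi.add_apply, Pi.smul_apply, smul_eq_mul]
        linarith
      · have h4 := mul_nonneg hηpos.le (hχ0 e)
        have h5 := hfg e
        simp only [Pi.add_apply, Pi.smul_apply, smul_eq_mul]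
        linarith
      · rw [netOut_add, netOut_smul, hχv, hfv]; ring
    have hle : ∑ e, f e ≤ ∑ e, (f + (-η) • χ') e := hmin hmem
    simp only [Pi.add_apply, Pi.smul_apply, smul_eq_mul, Finset.sum_add_distrib,
      ← Finset.mul_sum] at hle
    have hsum : 1 ≤ ∑ e, χ' e :=
      hχ1.trans (Finset.single_le_sum (fun e _ => hχ0 e) (Finset.mem_univ e₀))
    nlinarith
  · set S : Finset V := Finset.univ.filter fun x => Relation.ReflTransGen
      (fun x y => ∃ e, 0 < f e ∧ tail e = x ∧ head e = y) (head e₀) x with hS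
    have hmemS : ∀ x, x ∈ S ↔ Relation.ReflTransGen
      (fun x y => ∃ e, 0 < f e ∧ tail e = x ∧ head e = y) (head e₀) x := fun x => by simp [hS]
    have h1 := sum_netOut (tail := tail) (head := head) f S
    have h2 : ∑ e, ((if tail e ∈ S then f e else 0) - (if head e ∈ S then f e else 0))
        ≤ ∑ e, if e = e₀ then -f e₀ else 0 := by
      refine Finset.sum_le_sum fun e _ => ?_
      by_cases he : e = e₀
      · subst he
        have ht : tail e ∉ S := fun h => hreach ((hmemS _).mp h)
        have hh : head e ∈ S := (hmemS _).mpr Relation.ReflTransGen.refl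
        simp [ht, hh]
      · simp only [he, if_false]
        have hfe : 0 ≤ f e := hf0 e
        by_cases ht : tail e ∈ S
        · by_cases hh : head e ∈ S
          · simp [ht, hh]
          · have : ¬ 0 < f e := fun hpos => hh ((hmemS _).mpr
              (((hmemS _).mp ht).tail ⟨e, hpos, rfl, rfl⟩))
            simp only [ht, hh, if_true, if_false]
            linarith
        · simp only [ht, if_false]
          split_ifs <;> linarith
    rw [Finset.sum_ite_eq' Finset.univ e₀, if_pos (Finset.mem_univ _), ← h1] at h2
    have hfv' : ∀ v, netOut tail head f v =
      (if v = s then d else 0) - (if v = t then d else 0) := hfv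
    simp only [hfv', Finset.sum_sub_distrib, Finset.sum_ite_eq'] at h2
    have h3 : 0 ≤ if s ∈ S then d else 0 := by split_ifs <;> linarith
    have h4 : (if t ∈ S then d else 0) ≤ d := by split_ifs <;> linarith
    linarith

end Flow

namespace RoutingInstance

variable {V E : Type*} [Fintype E] [DecidableEq V] {k : ℕ} (G : RoutingInstance V E k)

theorem isFeasible_iff (f : Fin k → E → ℝ) : G.IsFeasible f ↔ (∀ i e, 0 ≤ f i e) ∧
    ∀ i v, netOut G.tail G.head (f i) v = (if v = G.source i then G.demand i else 0)
      - (if v = G.sink i then G.demand i else 0) :=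
  ⟨fun h => ⟨h.nonneg, h.conservation⟩, fun h => ⟨h.1, h.2⟩⟩

theorem exists_mem_flowBody_le [Fintype V] {g : Fin k → E → ℝ} (hg : G.IsFeasible g) :
    ∃ f ∈ G.flowBody, ∀ i e, f i e ≤ g i e := by
  choose f h1 h2 h3 h4 using fun i => exists_flow_le_demand (G.demand_nonneg i) (hg.nonneg i)
    (hg.conservation i)
  exact ⟨f, ⟨(G.isFeasible_iff f).mpr ⟨h1, h4⟩, h3⟩, h2⟩

theorem isCompact_flowBody : IsCompact G.flowBody := by
  have heq : G.flowBody = Set.Icc 0 (fun i _ => G.demand i) ∩ {f | ∀ i v,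
      netOut G.tail G.head (f i) v = (if v = G.source i then G.demand i else 0)
        - (if v = G.sink i then G.demand i else 0)} := by
    ext f
    simp only [flowBody, isFeasible_iff, Set.mem_ofPred_eq, Set.mem_inter_iff, Set.mem_Icc,
      Pi.le_def, Pi.zero_apply]
    tauto
  rw [heq]
  refine isCompact_Icc.inter_right ?_
  simp only [Set.ofPred_forall]
  exact isClosed_iInter fun i => isClosed_iInter fun v =>
    isClosed_eq ((continuous_netOut G.tail G.head v).comp (continuous_apply i)) continuous_const

theorem convex_flowBody : Convex ℝ G.flowBody := by
  rintro f ⟨hf, hfd⟩ g ⟨hg, hgd⟩ a b ha hb hab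
  rw [isFeasible_iff] at hf hg
  refine ⟨(G.isFeasible_iff _).mpr ⟨fun i e => ?_, fun i v => ?_⟩, fun i e => ?_⟩
  · exact add_nonneg (mul_nonneg ha (hf.1 i e)) (mul_nonneg hb (hg.1 i e))
  · change netOut G.tail G.head (a • f i + b • g i) v = _
    rw [netOut_add, netOut_smul, netOut_smul, hf.2, hg.2, ← add_mul, hab, one_mul]
  · calc a * f i e + b * g i e ≤ a * G.demand i + b * G.demand i :=
          add_le_add (mul_le_mul_of_nonneg_left (hfd i e) ha)
            (mul_le_mul_of_nonneg_left (hgd i e) hb)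
      _ = G.demand i := by rw [← add_mul, hab, one_mul]

theorem edgeFlow_le_totalDemand {f : Fin k → E → ℝ} (hf : f ∈ G.flowBody) (e : E) :
    edgeFlow f e ≤ G.totalDemand :=
  Finset.sum_le_sum fun i _ => hf.2 i e

end RoutingInstance

section Latency

theorem Polynomial.eval_nonneg_of_coeff_nonneg {p : Polynomial ℝ} (hp : ∀ j, 0 ≤ p.coeff j) {x : ℝ}
    (hx : 0 ≤ x) : 0 ≤ p.eval x := by
  rw [Polynomial.eval_eq_sum_range]
  exact Finset.sum_nonneg fun j _ => mul_nonneg (hp j) (pow_nonneg hx j)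

theorem Polynomial.eval_mono_of_coeff_nonneg {p : Polynomial ℝ} (hp : ∀ j, 0 ≤ p.coeff j)
    {x y : ℝ} (hx : 0 ≤ x) (hxy : x ≤ y) : p.eval x ≤ p.eval y := by
  rw [Polynomial.eval_eq_sum_range, Polynomial.eval_eq_sum_range]
  exact Finset.sum_le_sum fun j _ => mul_le_mul_of_nonneg_left (pow_le_pow_left₀ hx hxy j) (hp j)

theorem Polynomial.convexOn_mul_eval {p : Polynomial ℝ} (hp : ∀ j, 0 ≤ p.coeff j) :
    ConvexOn ℝ (Set.Ici 0) fun x => x * p.eval x := by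
  have h : ∀ s : Finset ℕ, ConvexOn ℝ (Set.Ici (0 : ℝ))
      fun x => ∑ j ∈ s, p.coeff j * x ^ (j + 1) := by
    intro s
    induction s using Finset.induction_on with
    | empty => simpa using convexOn_const (0 : ℝ) (convex_Ici (0 : ℝ))
    | insert a s ha ih =>
      simp only [Finset.sum_insert ha]
      exact ((convexOn_pow (a + 1)).smul (hp a)).add ih
  convert h (Finset.range (p.natDegree + 1)) using 2 with x
  rw [Polynomial.eval_eq_sum_range, Finset.mul_sum]
  exact Finset.sum_congr rfl fun j _ => by ring

variable {E : Type*} [Fintype E] {k : ℕ} {l : E → Polynomial ℝ}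

theorem continuous_totalLatency (l : E → Polynomial ℝ) :
    Continuous fun f : Fin k → E → ℝ => totalLatency l f := by
  unfold totalLatency edgeFlow
  fun_prop

theorem totalLatency_mono (hl : ∀ e j, 0 ≤ (l e).coeff j) {f g : Fin k → E → ℝ}
    (hf : ∀ i e, 0 ≤ f i e) (hfg : ∀ i e, f i e ≤ g i e) :
    totalLatency l f ≤ totalLatency l g := by
  refine Finset.sum_le_sum fun e _ => ?_
  have h0 : 0 ≤ edgeFlow f e := Finset.sum_nonneg fun i _ => hf i e
  have h1 : edgeFlow f e ≤ edgeFlow g e := Finset.sum_le_sum fun i _ => hfg i e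
  exact mul_le_mul h1 (Polynomial.eval_mono_of_coeff_nonneg (hl e) h0 h1)
    (Polynomial.eval_nonneg_of_coeff_nonneg (hl e) h0) (h0.trans h1)

theorem totalLatency_nonneg (hl : ∀ e j, 0 ≤ (l e).coeff j) {f : Fin k → E → ℝ}
    (hf : ∀ i e, 0 ≤ f i e) : 0 ≤ totalLatency l f :=
  Finset.sum_nonneg fun e _ => by
    have h0 : 0 ≤ edgeFlow f e := Finset.sum_nonneg fun i _ => hf i e
    exact mul_nonneg h0 (Polynomial.eval_nonneg_of_coeff_nonneg (hl e) h0)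

theorem convexOn_totalLatency (hl : ∀ e j, 0 ≤ (l e).coeff j) {C : Set (Fin k → E → ℝ)}
    (hC : Convex ℝ C) (hnn : ∀ f ∈ C, ∀ i e, 0 ≤ f i e) : ConvexOn ℝ C (totalLatency l) := by
  refine ⟨hC, fun f hf g hg a b ha hb hab => ?_⟩
  simp only [totalLatency, smul_eq_mul, Finset.mul_sum, ← Finset.sum_add_distrib]
  refine Finset.sum_le_sum fun e _ => ?_
  have hlin : edgeFlow (a • f + b • g) e = a • edgeFlow f e + b • edgeFlow g e := by
    simp [edgeFlow, Finset.sum_add_distrib, Finset.mul_sum]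
  rw [hlin]
  exact (Polynomial.convexOn_mul_eval (hl e)).2 (edgeFlow_nonneg (hnn f hf) e)
    (edgeFlow_nonneg (hnn g hg) e) ha hb hab

theorem RoutingInstance.totalLatency_le {V : Type*} [DecidableEq V] (G : RoutingInstance V E k)
    {r : ℕ} {K : ℝ} (hl : ∀ e, IsStandardLatency r K G.totalDemand (l e)) {f : Fin k → E → ℝ}
    (hf : f ∈ G.flowBody) : totalLatency l f ≤ Fintype.card E * (K * G.totalDemand) := by
  have hle : ∀ e ∈ Finset.univ, edgeFlow f e * (l e).eval (edgeFlow f e) ≤ K * G.totalDemand := by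
    intro e _
    have h0 := edgeFlow_nonneg hf.1.nonneg e
    have h1 := G.edgeFlow_le_totalDemand hf e
    rw [mul_comm K]
    exact mul_le_mul h1 ((hl e).eval_le _ h0 h1)
      (Polynomial.eval_nonneg_of_coeff_nonneg (hl e).coeff_nonneg h0) (h0.trans h1)
  simpa [totalLatency] using Finset.sum_le_card_nsmul _ _ _ hle

theorem RoutingInstance.exists_isOptimal {V : Type*} [Fintype V] [DecidableEq V]
    (G : RoutingInstance V E k) (hl : ∀ e j, 0 ≤ (l e).coeff j) (hG : ∃ f, G.IsFeasible f) :
    ∃ f ∈ G.flowBody, G.IsOptimal l f := by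
  obtain ⟨g, hg⟩ := hG
  obtain ⟨f₀, hf₀, -⟩ := G.exists_mem_flowBody_le hg
  obtain ⟨f, hf, hmin⟩ := G.isCompact_flowBody.exists_isMinOn ⟨f₀, hf₀⟩
    (continuous_totalLatency l).continuousOn
  refine ⟨f, hf, hf.1, fun g hg => ?_⟩
  obtain ⟨g', hg', hle⟩ := G.exists_mem_flowBody_le hg
  exact (hmin hg').trans (totalLatency_mono hl hg'.1.nonneg hle)

end Latency

theorem cutQueries_add_two_le {n N : ℕ} (hn : 1 ≤ n) (hnN : n ≤ N) (hN : 2 ≤ N) :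
    ((cutQueries n + 2 : ℕ) : ℝ) ≤ 1540 * ((N : ℝ) ^ 4 * Real.log N) := by
  have hn1 : (1 : ℝ) ≤ n := by exact_mod_cast hn
  have hnx : (n : ℝ) ≤ N := by exact_mod_cast hnN
  have hx : (2 : ℝ) ≤ N := by exact_mod_cast hN
  set x : ℝ := (N : ℝ)
  have hlog : (1 / 2 : ℝ) ≤ Real.log x :=
    (by linarith [Real.log_two_gt_d9] : (1 / 2 : ℝ) ≤ Real.log 2).trans
      (Real.log_le_log (by norm_num) hx)
  have hx3 : (8 : ℝ) ≤ x ^ 3 := by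
    calc (8 : ℝ) = 2 ^ 3 := by norm_num
      _ ≤ x ^ 3 := by gcongr
  have h4 : 4 ≤ x ^ 3 * Real.log x := by nlinarith
  have hln : 0 ≤ Real.log n := Real.log_nonneg hn1
  have hT : (localSteps n : ℝ) ≤ 513 * (x ^ 3 * Real.log x) := by
    have h1 : (⌊512 * (n : ℝ) ^ 3 * Real.log n⌋₊ : ℝ) ≤ 512 * (n : ℝ) ^ 3 * Real.log n :=
      Nat.floor_le (by positivity)
    have h2 : 512 * (n : ℝ) ^ 3 * Real.log n ≤ 512 * x ^ 3 * Real.log x := by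
      gcongr
    rw [localSteps]
    push_cast
    linarith
  have h3 : (localSteps n : ℝ) * (2 * n + 1) ≤ 513 * (x ^ 3 * Real.log x) * (3 * x) := by
    gcongr
    linarith
  have h5 : 2 * (n : ℝ) + 2 ≤ x ^ 3 * Real.log x * x := by nlinarith
  rw [cutQueries]
  push_cast
  calc 2 * (n : ℝ) + localSteps n * (2 * n + 1) + 2
      ≤ x ^ 3 * Real.log x * x + 513 * (x ^ 3 * Real.log x) * (3 * x) := by linarith
    _ = 1540 * (x ^ 4 * Real.log x) := by ring

theorem ellipsoidRounds_le {n N : ℕ} (hn : 1 ≤ n) (hnN : n ≤ N) (hN : 2 ≤ N) {R S : ℝ}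
    (hR : 1 ≤ R) (hRS : R ≤ S) :
    (ellipsoidRounds n R : ℝ) ≤ 94 * ((N : ℝ) ^ 3 * Real.log (2 + S)) := by
  have hn1 : (1 : ℝ) ≤ n := by exact_mod_cast hn
  have hnx : (n : ℝ) ≤ N := by exact_mod_cast hnN
  have hx : (2 : ℝ) ≤ N := by exact_mod_cast hN
  set x : ℝ := (N : ℝ)
  set L := Real.log (2 + S)
  have hlog2 : Real.log 2 ≤ L := Real.log_le_log (by norm_num) (by linarith)
  have hL : (1 / 2 : ℝ) ≤ L := (by linarith [Real.log_two_gt_d9] : (1 / 2 : ℝ) ≤ _).trans hlog2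
  have hLR : Real.log R ≤ L := Real.log_le_log (by linarith) (by linarith)
  have h4R : Real.log (4 * R) ≤ 3 * L := by
    rw [Real.log_mul (by norm_num) (by linarith), show (4 : ℝ) = 2 ^ 2 by norm_num, Real.log_pow]
    push_cast
    linarith
  have h4R0 : 0 ≤ Real.log (4 * R) := Real.log_nonneg (by linarith)
  have hln0 : 0 ≤ Real.log n := Real.log_nonneg hn1
  have hln : Real.log n ≤ x := by
    have := Real.log_le_sub_one_of_pos (by linarith : (0 : ℝ) < n)
    linarith
  have hxL : x ≤ 2 * (x * L) := by nlinarith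
  have hLx : 2 * L ≤ x * L := by nlinarith
  have hsum : 2 * Real.log n + Real.log (4 * R) ≤ 6 * (x * L) := by linarith
  have h1 : (⌊40 / 3 * (n : ℝ) ^ 2 * (2 * Real.log n + Real.log (4 * R))⌋₊ : ℝ)
      ≤ 40 / 3 * (n : ℝ) ^ 2 * (2 * Real.log n + Real.log (4 * R)) :=
    Nat.floor_le (by positivity)
  have h2 : 40 / 3 * (n : ℝ) ^ 2 * (2 * Real.log n + Real.log (4 * R))
      ≤ 40 / 3 * x ^ 2 * (6 * (x * L)) := by gcongr
  have hx3 : (8 : ℝ) ≤ x ^ 3 := by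
    calc (8 : ℝ) = 2 ^ 3 := by norm_num
      _ ≤ x ^ 3 := by gcongr
  have h3 : 1 ≤ x ^ 3 * L := by nlinarith
  have h4 : 40 / 3 * x ^ 2 * (6 * (x * L)) = 80 * (x ^ 3 * L) := by ring
  rw [ellipsoidRounds]
  push_cast
  linarith

theorem exists_compact_convex_minimization {W : Type*} [NormedAddCommGroup W] [NormedSpace ℝ W]
    [FiniteDimensional ℝ W] {C : Set W} (hC : IsCompact C) (hconv : Convex ℝ C)
    (hne : C.Nonempty) {N : ℕ} (hN : Module.finrank ℝ W ≤ N) (hN2 : 2 ≤ N) {M ε δ S : ℝ}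
    (hε : 0 < ε) (hεM : ε ≤ M) (hS : M / ε ≤ S) (hδε : 50000 * (N : ℝ) ^ 5 * δ ≤ ε) :
    ∃ A : QueryAlgorithm C, ∀ F ψ, ConvexOn ℝ C F → (∀ x ∈ C, ∀ y ∈ C, F x - F y ≤ M) →
      IsZeroOrderOracle C F δ ψ →
        (A.numQueries ψ : ℝ) ≤ 144760 * ((N : ℝ) ^ 7 * Real.log N * Real.log (2 + S)) ∧
        ∀ x ∈ C, F (A.result ψ).1 ≤ F x + ε := by
  obtain ⟨p, hp⟩ := hne
  have hx2 : (2 : ℝ) ≤ N := by exact_mod_cast hN2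
  have hR : 1 ≤ M / ε := (one_le_div hε).mpr hεM
  obtain ⟨n, hnW, L, hL1, hL2, hL3⟩ := exists_coordinates hC hp
  rcases Nat.eq_zero_or_pos n with rfl | hnpos
  · have huniq : ∀ x ∈ C, x = p := by
      intro x hx
      obtain ⟨y, rfl⟩ := hL3 x hx
      rw [Subsingleton.elim y 0]; simp
    refine ⟨.output ⟨p, hp⟩, fun F ψ _ _ _ => ⟨?_, fun x hx => ?_⟩⟩
    · have h1 : 0 ≤ Real.log N := Real.log_nonneg (by linarith)
      have h2 : 0 ≤ Real.log (2 + S) := Real.log_nonneg (by linarith)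
      simp only [QueryAlgorithm.numQueries, Nat.cast_zero]
      positivity
    · rw [huniq x hx]
      simp only [QueryAlgorithm.result]
      linarith
  have : NeZero n := ⟨hnpos.ne'⟩
  have hnN : n ≤ N := hnW.trans hN
  have hnx : (n : ℝ) ≤ N := by exact_mod_cast hnN
  let φ : EuclideanSpace ℝ (Fin n) →ᵃ[ℝ] W := L.toAffineMap + AffineMap.const ℝ _ p
  have hφ : ∀ y, φ y = L y + p := fun y => rfl
  have hcont : Continuous φ := AffineMap.continuous_of_finiteDimensional φ
  have hP : 0 < 50000 * (N : ℝ) ^ 5 := by positivity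
  obtain ⟨q, hq, hspec⟩ := exists_convex_minimization (n := n) (C := φ ⁻¹' C)
    (δ := ε / (50000 * (N : ℝ) ^ 5)) (M := M) (ε := ε) (hC.isClosed.preimage hcont)
    (hconv.affine_preimage φ) (by simpa [hφ] using hp) hL1 hL2 (by positivity) hε hεM (by
      have h5 : (n : ℝ) ^ 5 ≤ (N : ℝ) ^ 5 := by gcongr
      have h6 : (2 : ℝ) ^ 5 ≤ (N : ℝ) ^ 5 := by gcongr
      rw [mul_div_assoc', div_le_iff₀ hP]
      nlinarith)
  let ι : φ ⁻¹' C → C := fun w => ⟨φ w, w.2⟩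
  obtain ⟨A, hA⟩ := ((hq.comap ι).map ι).exists_algorithm
  refine ⟨A, fun F ψ hF hM hψ => ⟨?_, fun x hx => ?_⟩⟩
  · have h1 : (A.numQueries ψ : ℝ) ≤
        (ellipsoidRounds n (M / ε) : ℝ) * ((cutQueries n + 2 : ℕ) : ℝ) := by
      exact_mod_cast (hA ψ).1
    refine h1.trans ((mul_le_mul (ellipsoidRounds_le hnpos hnN hN2 hR hS)
      (cutQueries_add_two_le hnpos hnN hN2) (by positivity) ?_).trans (le_of_eq (by ring)))
    have h2 : 0 ≤ Real.log (2 + S) := Real.log_nonneg (by linarith)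
    positivity
  · rw [(hA ψ).2]
    obtain ⟨y, rfl⟩ := hL3 x hx
    refine hspec (F ∘ φ) (ψ ∘ ι) (hF.comp_affineMap φ) (fun u hu v hv => hM _ hu _ hv)
      (fun w => (hψ (ι w)).trans ?_) y hx
    rw [le_div_iff₀ hP]
    linarith

theorem RoutingInstance.exists_least_flow {V E : Type*} [Fintype V] [DecidableEq V] [Fintype E]
    {k : ℕ} (G : RoutingInstance V E k) (hcard : Fintype.card E * k ≤ 1)
    (hG : ∃ f, G.IsFeasible f) :
    ∃ f ∈ G.flowBody, ∀ g, G.IsFeasible g → ∀ i e, f i e ≤ g i e := by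
  obtain ⟨g, hg⟩ := hG
  obtain ⟨f₀, hf₀, -⟩ := G.exists_mem_flowBody_le hg
  obtain ⟨f, hf, hmin⟩ := G.isCompact_flowBody.exists_isMinOn
    (f := fun f : Fin k → E → ℝ => ∑ i, ∑ e, f i e) ⟨f₀, hf₀⟩ (by fun_prop)
  refine ⟨f, hf, fun g hg i e => ?_⟩
  obtain ⟨g', hg', hle⟩ := G.exists_mem_flowBody_le hg
  have hk : 0 < k := i.pos
  have hE : 0 < Fintype.card E := Fintype.card_pos_iff.mpr ⟨e⟩
  have hE1 : Subsingleton E := Fintype.card_le_one_iff_subsingleton.mp (by nlinarith)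
  have hk1 : Subsingleton (Fin k) := Fintype.card_le_one_iff_subsingleton.mp (by
    rw [Fintype.card_fin]; nlinarith)
  have h1 : ∑ i, ∑ e, f i e ≤ ∑ i, ∑ e, g' i e := hmin hg'
  simp only [Fintype.sum_subsingleton _ i, Fintype.sum_subsingleton _ e] at h1
  exact h1.trans (hle i e)

theorem mainTheorem2 :
    ∃ c : ℝ, 0 < c ∧ ∃ P : Polynomial ℝ,
      ∀ (V E : Type*) [Fintype V] [DecidableEq V] [Fintype E] (k : ℕ)
        (G : RoutingInstance V E k) (r : ℕ) (K ε δ : ℝ) (N : ℕ),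
        N = Fintype.card E * k →
        (∃ f, G.IsFeasible f) →
        0 < K → 0 < ε → 0 ≤ δ → P.eval (N : ℝ) * δ ≤ ε →
        ∃ A : QueryAlgorithm G.flowBody,
          ∀ l : E → Polynomial ℝ, (∀ e, IsStandardLatency r K G.totalDemand (l e)) →
          ∀ ψ : G.flowBody → ℝ, IsZeroOrderOracle G.flowBody (totalLatency l) δ ψ →
            (A.numQueries ψ : ℝ) ≤
                c * ((N : ℝ) ^ 7 * Real.log N
                  * Real.log (2 + N * K * G.totalDemand / ε)) ∧
              G.IsFeasible (A.result ψ).1 ∧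
              ∃ fstar : Fin k → E → ℝ, G.IsOptimal l fstar ∧
                totalLatency l (A.result ψ).1 - totalLatency l fstar ≤ ε := by
  refine ⟨144760, by norm_num, Polynomial.C 50000 * Polynomial.X ^ 5, ?_⟩
  intro V E _ _ _ k G r K ε δ N hN hG hK hε hδ hPδ
  simp only [Polynomial.eval_mul, Polynomial.eval_C, Polynomial.eval_pow, Polynomial.eval_X] at hPδ
  have hD : 0 ≤ G.totalDemand := Finset.sum_nonneg fun i _ => G.demand_nonneg i
  have hlogS : 0 ≤ Real.log (2 + N * K * G.totalDemand / ε) := by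
    have : 0 ≤ N * K * G.totalDemand / ε := by positivity
    exact Real.log_nonneg (by linarith)
  have hbound : 0 ≤ 144760 * ((N : ℝ) ^ 7 * Real.log N
      * Real.log (2 + N * K * G.totalDemand / ε)) := by
    have := Real.log_natCast_nonneg N
    positivity
  by_cases hN2 : 2 ≤ N
  swap
  · obtain ⟨f, hf, hleast⟩ := G.exists_least_flow (by omega) hG
    refine ⟨.output ⟨f, hf⟩, fun l hl ψ _ => ⟨?_, hf.1, f, ⟨hf.1, fun g hg => ?_⟩, ?_⟩⟩
    · simpa [QueryAlgorithm.numQueries] using hbound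
    · exact totalLatency_mono (fun e => (hl e).coeff_nonneg) hf.1.nonneg (hleast g hg)
    · simp only [QueryAlgorithm.result, sub_self]; exact hε.le
  obtain ⟨g, hg⟩ := id hG
  obtain ⟨f₀, hf₀, -⟩ := G.exists_mem_flowBody_le hg
  set M : ℝ := Fintype.card E * (K * G.totalDemand) with hM
  have hrange : ∀ l : E → Polynomial ℝ, (∀ e, IsStandardLatency r K G.totalDemand (l e)) →
      ∀ x ∈ G.flowBody, ∀ y ∈ G.flowBody, totalLatency l x - totalLatency l y ≤ M := by
    intro l hl x hx y hy
    have h1 := G.totalLatency_le hl hx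
    have h2 := totalLatency_nonneg (fun e => (hl e).coeff_nonneg) hy.1.nonneg
    linarith
  rcases le_or_gt ε M with hεM | hMε
  swap
  · refine ⟨.output ⟨f₀, hf₀⟩, fun l hl ψ _ => ⟨?_, hf₀.1, ?_⟩⟩
    · simpa [QueryAlgorithm.numQueries] using hbound
    · obtain ⟨fstar, hfs, hopt⟩ := G.exists_isOptimal (fun e => (hl e).coeff_nonneg) hG
      exact ⟨fstar, hopt, (hrange l hl f₀ hf₀ fstar hfs).trans hMε.le⟩
  have hfin : Module.finrank ℝ (Fin k → E → ℝ) = N := by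
    simp [Module.finrank_pi_fintype, hN, mul_comm]
  have hS : M / ε ≤ N * K * G.totalDemand / ε := by
    have hle : (Fintype.card E : ℝ) ≤ N := by
      rw [hN]
      exact_mod_cast Nat.le_mul_of_pos_right _ (Nat.pos_of_ne_zero fun h => by simp [h] at hN; omega)
    rw [hM, ← mul_assoc]
    gcongr
  obtain ⟨A, hA⟩ := exists_compact_convex_minimization G.isCompact_flowBody G.convex_flowBody
    ⟨f₀, hf₀⟩ hfin.le hN2 hε hεM hS hPδ
  refine ⟨A, fun l hl ψ hψ => ?_⟩
  obtain ⟨h1, h2⟩ := hA (totalLatency l) ψ (convexOn_totalLatency (fun e => (hl e).coeff_nonneg)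
    G.convex_flowBody fun f hf => hf.1.nonneg) (hrange l hl) hψ
  obtain ⟨fstar, hfs, hopt⟩ := G.exists_isOptimal (fun e => (hl e).coeff_nonneg) hG
  exact ⟨h1, (A.result ψ).2.1, fstar, hopt, by linarith [h2 fstar hfs]⟩
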